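/- **Setting.** A flat affine manifold $(M,\nabla)$ of dimension $n$ is a smooth ($C^\infty$, Hausdorff, second countable) manifold with an atlas, modelled on $\mathbb R^n$, whose transition maps are (locally) affine; $\nabla$ is the flat torsion-free connection whose flat coordinates are the charts of this affine atlas. A Riemannian metric $g$ on $M$ is Hessian if around each point there are affine coordinates $x^1,\dots,x^n$ and a smooth function $\varphi$ with $g=\sum \frac{\partial^2\varphi}{\partial x^i\partial x^j}\,dx^i dx^j$. A smooth vector field $\xi$ on $M$ is affine if its local flow preserves the affine structure. A selfsimilar Hessian manifold $(M,\nabla,g,\xi)$ is a flat affine manifold with a Hessian metric $g$ and an affine vector field $\xi$ such that $\mathcal L_\xi g=2g$. A Kähler manifold $(N,I,g)$ is a complex manifold with an $I$-invariant Riemannian metric $g$ whose fundamental form $\omega=g(I\cdot,\cdot)$ is closed; it is selfsimilar with respect to a smooth vector field $\zeta$ if $\zeta$ is holomorphic ($\mathcal L_\zeta I=0$) and $\mathcal L_\zeta g=2g$. A development map of $M$ is a local affine diffeomorphism $\mathrm{dev}:M\to\mathbb R^n$. Given one, identify $T_{(m,y)}(M\times\mathbb R^n)=T_mM\times\mathbb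 R^n$, let $\pi:M\times\mathbb R^n\to M$ be the projection, and put $$I(u,w)=\bigl(-(d\,\mathrm{dev}_m)^{-1}w,\ d\,\mathrm{dev}_m u\bigr),\qquad g^{\mathrm r}(X,Y)=(\pi^*g)(X,Y)+(\pi^*g)(IX,IY).$$ **Proposition.** Let $(M,\nabla,g,\xi)$ be a simply connected selfsimilar Hessian manifold of dimension $n$. Then $M$ has a development map, and for every development map $\mathrm{dev}:M\to\mathbb R^n$ there is a unique affine vector field $\hat\xi$ on $\mathbb R^n$ with $\mathrm{dev}_*\xi=\hat\xi$ (that is, $d\,\mathrm{dev}_m(\xi_m)=\hat\xi_{\mathrm{dev}(m)}$ for all $m\in M$). Moreover, with $\xi_1=\xi\times 0$ and $\xi_2=0\times\hat\xi$, the quadruple $(M\times\mathbb R^n, I, g^{\mathrm r},\xi_1+\xi_2)$ is a selfsimilar Kähler manifold: $I$ is an (integrable) complex structure, $g^{\mathrm r}$ is a Riemannian metric, $(M\times\mathbb R^n,I,g^{\mathrm r})$ is Kähler, $\xi_1+\xi_2$ is holomorphic, and $\mathcal L_{\xi_1+\xi_2}g^{\mathrm r}=2g^{\mathrm r}$. 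-/

import Mathlib

open Set Filter Bundle VectorField
open scoped Manifold ContDiff Topology

noncomputable section

/-! ### Flat affine manifolds

A flat affine manifold is a manifold modelled on a real vector space `V` with an atlas whose
transition maps are locally restrictions of affine maps, that is
`[ChartedSpace V M] [HasGroupoid M (affineGroupoid V)]`. The flat torsion-free connection is the one
whose flat coordinates are the charts of the (maximal) affine atlas. -/

section Affine

variable (V : Type*) [NormedAddCommGroup V] [NormedSpace ℝ V]

/-- The maps of `V` that are, near each point of a set, equal to an affine map. -/
def affinePregroupoid : Pregroupoid V where
  property f u := ∀ x ∈ u, ∃ A : V →ᴬ[ℝ] V, f =ᶠ[𝓝 x] A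
  comp := by
    intro f g u v hf hg _ _ _ x hx
    obtain ⟨A, hA⟩ := hf x hx.1
    obtain ⟨B, hB⟩ := hg (f x) hx.2
    refine ⟨B.comp A, ?_⟩
    have hfx : Tendsto f (𝓝 x) (𝓝 (f x)) := by
      have hc : ContinuousAt f x := A.continuous.continuousAt.congr hA.symm
      exact hc
    filter_upwards [hA, hfx.eventually hB] with y hy hy'
    simp only [Function.comp_apply, hy', ContinuousAffineMap.comp_apply]
    rw [hy]
  id_mem x _ := ⟨ContinuousAffineMap.id ℝ V, Filter.Eventually.of_forall fun _ => rfl⟩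
  locality := by
    intro f u _ h x hx
    obtain ⟨v, _, hxv, hv⟩ := h x hx
    exact hv x ⟨hx, hxv⟩
  congr := by
    intro f g u hu h hf x hx
    obtain ⟨A, hA⟩ := hf x hx
    refine ⟨A, ?_⟩
    filter_upwards [hA, hu.mem_nhds hx] with y hy hyu
    rw [h y hyu, hy]

/-- The groupoid of local homeomorphisms of `V` that are, together with their inverses, locally
restrictions of affine maps. -/
def affineGroupoid : StructureGroupoid V := (affinePregroupoid V).groupoid

theorem affineGroupoid_le_contDiffGroupoid :
    affineGroupoid V ≤ contDiffGroupoid ∞ 𝓘(ℝ, V) := by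
  refine groupoid_of_pregroupoid_le _ _ ?_
  intro f u hf
  have key : ContDiffOn ℝ ∞ f u := by
    intro x hx
    obtain ⟨A, hA⟩ := hf x hx
    exact (A.contDiff.contDiffAt.congr_of_eventuallyEq hA).contDiffWithinAt
  simpa [contDiffPregroupoid] using key

variable {V}

/-- A flat affine manifold is in particular a smooth manifold. -/
instance isManifold_of_affineGroupoid {M : Type*} [TopologicalSpace M] [ChartedSpace V M]
    [HasGroupoid M (affineGroupoid V)] : IsManifold 𝓘(ℝ, V) ∞ M where
  toHasGroupoid := hasGroupoid_of_le inferInstance (affineGroupoid_le_contDiffGroupoid V)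

variable {M M' : Type*} [TopologicalSpace M] [ChartedSpace V M]
  [TopologicalSpace M'] [ChartedSpace V M']

variable (V) in
/-- `f` is affine near `p`: in affine charts around `p` and `f p` it is, near `p`, the restriction
of an affine map of `V`. -/
def IsAffineAt (f : M → M') (p : M) : Prop :=
  ContinuousAt f p ∧ ∃ A : V →ᴬ[ℝ] V,
    ∀ᶠ q in 𝓝 p, chartAt V (f p) (f q) = A (chartAt V p q)

/-- A development map of a flat affine manifold: a local affine diffeomorphism `M → V`. -/
def IsDevelopmentMap (dev : M → V) : Prop :=
  IsLocalDiffeomorph 𝓘(ℝ, V) 𝓘(ℝ, V) ∞ dev ∧ ∀ p, IsAffineAt V dev p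

/-- A vector field `ξ` is affine if its (local) flow preserves the affine structure: around each
point there is a smooth local flow `φ` of `ξ` all of whose maps `φ t` are affine. -/
def IsAffineField (ξ : (p : M) → TangentSpace 𝓘(ℝ, V) p) : Prop :=
  ∀ p : M, ∃ U : Set M, IsOpen U ∧ p ∈ U ∧ ∃ ε : ℝ, 0 < ε ∧ ∃ φ : ℝ → M → M,
    ContMDiffOn (𝓘(ℝ, ℝ).prod 𝓘(ℝ, V)) 𝓘(ℝ, V) ∞ (fun z : ℝ × M => φ z.1 z.2)
      (Ioo (-ε) ε ×ˢ U) ∧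
    (∀ q ∈ U, φ 0 q = q ∧ IsMIntegralCurveOn (fun t => φ t q) ξ (Ioo (-ε) ε)) ∧
    ∀ t ∈ Ioo (-ε) ε, ∀ q ∈ U, IsAffineAt V (φ t) q

end Affine

/-! ### Vector fields, Lie derivatives, Kähler manifolds

Here `N` is a smooth manifold with model `J`. Tensorial identities at a point `p` are tested on all
vector fields that are smooth near `p`. -/

section Tensors

variable {W : Type*} [NormedAddCommGroup W] [NormedSpace ℝ W] {H : Type*} [TopologicalSpace H]
  (J : ModelWithCorners ℝ W H) {N : Type*} [TopologicalSpace N] [ChartedSpace H N]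

/-- The vector field `X` is smooth near `p`. -/
def SmoothFieldAt [IsManifold J ∞ N] (X : (q : N) → TangentSpace J q) (p : N) : Prop :=
  ContMDiffAt J J.tangent ∞ (fun q => (⟨q, X q⟩ : TangentBundle J N)) p

/-- The derivative `X f` of a function `f` along a vector field `X`. -/
def derivAlong (X : (q : N) → TangentSpace J q) (f : N → ℝ) (p : N) : ℝ :=
  mfderiv J 𝓘(ℝ, ℝ) f p (X p)

/-- Smooth Riemannian metrics on `N`. -/
abbrev SmoothMetric (N : Type*) [TopologicalSpace N] [ChartedSpace H N] [IsManifold J ∞ N] :=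
  ContMDiffRiemannianMetric J ∞ W (fun p : N => TangentSpace J p)

variable {J} [IsManifold J ∞ N]

/-- `(L_ξ g)(X, Y) = ξ (g(X, Y)) - g([ξ, X], Y) - g(X, [ξ, Y])`. -/
def lieDerivMetric (g : SmoothMetric J N) (ξ X Y : (q : N) → TangentSpace J q) (p : N) : ℝ :=
  derivAlong J ξ (fun q => g.inner q (X q) (Y q)) p
    - g.inner p (mlieBracket J ξ X p) (Y p) - g.inner p (X p) (mlieBracket J ξ Y p)

/-- `L_ξ g = 2 g`. -/
def LieDerivEqTwice (g : SmoothMetric J N) (ξ : (q : N) → TangentSpace J q) : Prop :=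
  ∀ (p : N) (X Y : (q : N) → TangentSpace J q), SmoothFieldAt J X p → SmoothFieldAt J Y p →
    lieDerivMetric g ξ X Y p = 2 * g.inner p (X p) (Y p)

variable (J) in
/-- The differential of a map `z : N → ℂᵐ`, as a map with values in `ℂᵐ`. -/
def coordDeriv {m : ℕ} (z : N → EuclideanSpace ℂ (Fin m)) (q : N) (v : TangentSpace J q) :
    EuclideanSpace ℂ (Fin m) :=
  mfderiv J 𝓘(ℝ, EuclideanSpace ℂ (Fin m)) z q v

/-- `I` is an (integrable) complex structure: `I² = -1`, and around each point there are
holomorphic coordinates, that is a local diffeomorphism `z` to some `ℂᵐ` with `dz ∘ I = i dz`.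
(Then `I = dz⁻¹ ∘ i ∘ dz` near the point, so `I` is smooth.) -/
structure IsComplexStructure (I : (p : N) → TangentSpace J p →L[ℝ] TangentSpace J p) : Prop where
  sq : ∀ (p : N) (v : TangentSpace J p), I p (I p v) = -v
  coords : ∀ p : N, ∃ (m : ℕ) (z : N → EuclideanSpace ℂ (Fin m)),
    IsLocalDiffeomorphAt J 𝓘(ℝ, EuclideanSpace ℂ (Fin m)) ∞ z p ∧
    ∀ᶠ q in 𝓝 p, ∀ v : TangentSpace J q,
      coordDeriv J z q (I q v) = Complex.I • coordDeriv J z q v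

/-- The exterior derivative of the two-form `Ω`, evaluated on three vector fields. -/
def extDerivTwoForm (Ω : (p : N) → TangentSpace J p → TangentSpace J p → ℝ)
    (X Y Z : (q : N) → TangentSpace J q) (p : N) : ℝ :=
  derivAlong J X (fun q => Ω q (Y q) (Z q)) p
    + derivAlong J Y (fun q => Ω q (Z q) (X q)) p
    + derivAlong J Z (fun q => Ω q (X q) (Y q)) p
    - Ω p (mlieBracket J X Y p) (Z p)
    - Ω p (mlieBracket J Y Z p) (X p)
    - Ω p (mlieBracket J Z X p) (Y p)

/-- `(N, I, g)` is a Kähler manifold: `I` is a complex structure, `g` is `I`-invariant, and the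
fundamental form `Ω(X, Y) = g(I X, Y)` is closed. -/
structure IsKahler (I : (p : N) → TangentSpace J p →L[ℝ] TangentSpace J p)
    (g : SmoothMetric J N) : Prop where
  complex : IsComplexStructure I
  hermitian : ∀ (p : N) (v w : TangentSpace J p), g.inner p (I p v) (I p w) = g.inner p v w
  closed : ∀ (p : N) (X Y Z : (q : N) → TangentSpace J q),
    SmoothFieldAt J X p → SmoothFieldAt J Y p → SmoothFieldAt J Z p →
      extDerivTwoForm (fun q v w => g.inner q (I q v) w) X Y Z p = 0

/-- The (real, smooth) vector field `ξ` is holomorphic: `L_ξ I = 0`, that is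
`[ξ, I X] = I [ξ, X]` for all `X`. -/
def IsHolomorphicField (I : (p : N) → TangentSpace J p →L[ℝ] TangentSpace J p)
    (ξ : (q : N) → TangentSpace J q) : Prop :=
  (∀ p, SmoothFieldAt J ξ p) ∧
  ∀ (p : N) (X : (q : N) → TangentSpace J q), SmoothFieldAt J X p →
    mlieBracket J ξ (fun q => I q (X q)) p = I p (mlieBracket J ξ X p)

/-- `(N, I, g, ξ)` is a selfsimilar Kähler manifold. -/
structure IsSelfsimilarKahler (I : (p : N) → TangentSpace J p →L[ℝ] TangentSpace J p)
    (g : SmoothMetric J N) (ξ : (q : N) → TangentSpace J q) : Prop where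
  kahler : IsKahler I g
  holomorphic : IsHolomorphicField I ξ
  homothetic : LieDerivEqTwice g ξ

end Tensors

/-! ### Selfsimilar Hessian manifolds and the r-map -/

section Hessian

variable {V : Type*} [NormedAddCommGroup V] [NormedSpace ℝ V]
  {M : Type*} [TopologicalSpace M] [ChartedSpace V M] [HasGroupoid M (affineGroupoid V)]

/-- `g` is a Hessian metric: around each point there are flat coordinates `x` (an affine chart)
in which `g` is the Hessian of a smooth function `φ`. -/
def IsHessianMetric (g : SmoothMetric 𝓘(ℝ, V) M) : Prop :=
  ∀ p : M, ∃ x ∈ (affineGroupoid V).maximalAtlas M, p ∈ x.source ∧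
    ∃ φ : V → ℝ, ContDiffOn ℝ ∞ φ x.target ∧
      ∀ q ∈ x.source, ∀ v w : TangentSpace 𝓘(ℝ, V) q,
        g.inner q v w =
          fderiv ℝ (fderiv ℝ φ) (x q) (mfderiv 𝓘(ℝ, V) 𝓘(ℝ, V) x q v)
            (mfderiv 𝓘(ℝ, V) 𝓘(ℝ, V) x q w)

/-- `(M, ∇, g, ξ)` is a selfsimilar Hessian manifold. -/
structure IsSelfsimilarHessian (g : SmoothMetric 𝓘(ℝ, V) M)
    (ξ : (p : M) → TangentSpace 𝓘(ℝ, V) p) : Prop where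
  hessian : IsHessianMetric g
  smooth : ∀ p, SmoothFieldAt 𝓘(ℝ, V) ξ p
  affine : IsAffineField ξ
  homothetic : LieDerivEqTwice g ξ

/-- The complex structure on `M × V` (the tangent bundle `TM`, trivialized by `dev`):
for `u` tangent to `M` and `w` tangent to `V`, `I (u, w) = (-(d dev)⁻¹ w, d dev u)`, that is
`I (∂/∂xⁱ) = ∂/∂yⁱ` and `I (∂/∂yⁱ) = -∂/∂xⁱ` in the affine coordinates `x` given by `dev`. -/
def rComplexStructure (dev : M → V) (p : M × V) :
    TangentSpace (𝓘(ℝ, V).prod 𝓘(ℝ, V)) p →L[ℝ] TangentSpace (𝓘(ℝ, V).prod 𝓘(ℝ, V)) p :=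
  let D : V →L[ℝ] V := mfderiv 𝓘(ℝ, V) 𝓘(ℝ, V) dev p.1
  ContinuousLinearMap.prod (-(D.inverse.comp (ContinuousLinearMap.snd ℝ V V)))
    (D.comp (ContinuousLinearMap.fst ℝ V V))

/-- The pullback `π^* g` of a metric along the projection `π : M × V → M`. -/
def pullbackMetric (g : SmoothMetric 𝓘(ℝ, V) M) (p : M × V)
    (X Y : TangentSpace (𝓘(ℝ, V).prod 𝓘(ℝ, V)) p) : ℝ :=
  g.inner p.1 (mfderiv (𝓘(ℝ, V).prod 𝓘(ℝ, V)) 𝓘(ℝ, V) Prod.fst p X)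
    (mfderiv (𝓘(ℝ, V).prod 𝓘(ℝ, V)) 𝓘(ℝ, V) Prod.fst p Y)

/-- The bilinear form `gʳ(X, Y) = (π^* g)(X, Y) + (π^* g)(I X, I Y)` on `M × V`. -/
def rMetric (g : SmoothMetric 𝓘(ℝ, V) M) (dev : M → V) (p : M × V)
    (X Y : TangentSpace (𝓘(ℝ, V).prod 𝓘(ℝ, V)) p) : ℝ :=
  pullbackMetric g p X Y
    + pullbackMetric g p (rComplexStructure dev p X) (rComplexStructure dev p Y)

/-- The affine field `η` on `V` is the image of `ξ` under `dev`: `dev_* ξ = η`. -/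
def IsDevelopedField (dev : M → V) (ξ : (p : M) → TangentSpace 𝓘(ℝ, V) p) (η : V →ᴬ[ℝ] V) :
    Prop :=
  ∀ p : M, (mfderiv 𝓘(ℝ, V) 𝓘(ℝ, V) dev p (ξ p) : V) = η (dev p)

/-- The vector field `ξ₁ + ξ₂` on `M × V`, where `ξ₁ = ξ × 0` and `ξ₂ = 0 × η`. -/
def sumField (ξ : (p : M) → TangentSpace 𝓘(ℝ, V) p) (η : V →ᴬ[ℝ] V) (p : M × V) :
    TangentSpace (𝓘(ℝ, V).prod 𝓘(ℝ, V)) p :=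
  ((ξ p.1, 0) + (0, η p.2) : V × V)

end Hessian

end

/-! Everything becomes explicit in the coordinates given by a development map. Existence: germs of
affine coordinates form a bundle over `M` with discrete fibre the affine group, hence a covering. As
`M` is simply connected, the identity lifts to a global section, and a section is a development map
(`exists_locally_affineEquiv_comp_chart`). The field: read through `dev`, the flow of `ξ` is affine
on a fixed ball for each small time, so its difference quotients are affine there. Their limit is
affine because affine functions form a finite-dimensional, hence closed, space. The local answers
agree because an affine map is determined by its germ and `M` is connected
(`IsAffineField.exists_developedField`). The Kähler structure: use `z = x + iy` with `x = dev`.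
There `I` is multiplication by `i`, and `gʳ` is `h(x)` on both the real and the imaginary part, with
`h` the Hessian of a local potential. Closedness of the fundamental form is the total symmetry of
the third derivative of the potential (`IsPotentialNear.closed`). The field is `(η x, η y)`; its
derivative is two copies of the linear part of `η`, so it commutes with `i`, and since `h` depends
on `x` alone the homothety equation for `gʳ` is two instances of the one for `g`
(`lieDerivEqTwice_rSmoothMetric`). The bridge from invariant definitions to coordinates is `dΦ [X,
Y] = X (Y Φ) - Y (X Φ)` for vector valued `Φ` (`fieldDeriv_mlieBracket`): derivatives of the
components of test fields cancel, leaving pointwise identities. -/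

noncomputable section

/-! ### Vector valued maps, fields and brackets on a manifold -/

section Calculus

theorem two_le_infty : (2 : WithTop ℕ∞) ≤ ∞ := by
  have h : ((2 : ℕ∞) : WithTop ℕ∞) ≤ ((⊤ : ℕ∞) : WithTop ℕ∞) := by
    exact WithTop.coe_le_coe.2 le_top
  exact h

theorem one_le_infty : (1 : WithTop ℕ∞) ≤ ∞ := one_le_two.trans two_le_infty

variable {W : Type*} [NormedAddCommGroup W] [NormedSpace ℝ W] {H : Type*} [TopologicalSpace H]
  {J : ModelWithCorners ℝ W H} {N : Type*} [TopologicalSpace N] [ChartedSpace H N]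
  {F : Type*} [NormedAddCommGroup F] [NormedSpace ℝ F]

variable (J) in
/-- The differential of a vector valued map, as a linear map on the model space. -/
def vderiv (f : N → F) (q : N) : W →L[ℝ] F := mfderiv J 𝓘(ℝ, F) f q

variable (J) in
/-- The derivative of a vector valued map along a vector field. -/
def fieldDeriv (f : N → F) (X : (q : N) → TangentSpace J q) (q : N) : F := vderiv J f q (X q)

variable (J) in
/-- A vector field on a manifold, read in the chart at `p`. -/
def chartField (p : N) (X : (q : N) → TangentSpace J q) : W → W :=
  mpullbackWithin 𝓘(ℝ, W) J (extChartAt J p).symm X (range J)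

theorem HasMFDerivAt.vderiv_eq {f : N → F} {q : N} {f' : W →L[ℝ] F}
    (h : HasMFDerivAt J 𝓘(ℝ, F) f q f') : vderiv J f q = f' := h.mfderiv

theorem hasMFDerivAt_iff_hasFDerivAt_chart [J.Boundaryless] {f : N → F} {q : N}
    {f' : W →L[ℝ] F} :
    HasMFDerivAt J 𝓘(ℝ, F) f q f' ↔ ContinuousAt f q ∧
      HasFDerivAt (f ∘ (extChartAt J q).symm) f' (extChartAt J q q) := by
  have h : HasMFDerivAt J 𝓘(ℝ, F) f q f' ↔ ContinuousAt f q ∧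
      HasFDerivWithinAt (f ∘ (extChartAt J q).symm) f' (range J) (extChartAt J q q) := Iff.rfl
  rw [h, J.range_eq_univ, hasFDerivWithinAt_univ]

theorem MDifferentiableAt.hasFDerivAt_comp_extChartAt_symm [J.Boundaryless] {f : N → F} {q : N}
    (hf : MDifferentiableAt J 𝓘(ℝ, F) f q) :
    HasFDerivAt (f ∘ (extChartAt J q).symm) (vderiv J f q) (extChartAt J q q) :=
  (hasMFDerivAt_iff_hasFDerivAt_chart.1 hf.hasMFDerivAt).2

/-- Chain rule: the field in the chart is formed with the inverse of the differential of the inverse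
chart, which cancels the factor produced by the composition. -/
theorem fderiv_comp_extChartAt_symm_apply [J.Boundaryless] [IsManifold J ∞ N] [CompleteSpace W]
    (X : (q : N) → TangentSpace J q) {f : N → F} {p : N} {y : W} (hy : y ∈ (extChartAt J p).target)
    (hf : MDifferentiableAt J 𝓘(ℝ, F) f ((extChartAt J p).symm y)) :
    fderiv ℝ (f ∘ (extChartAt J p).symm) y
      (chartField J p X y) = fieldDeriv J f X ((extChartAt J p).symm y) := by
  have : IsManifold J 1 N := IsManifold.of_le (n := ∞) (by simp)
  have hinv := isInvertible_mfderivWithin_extChartAt_symm (I := J) hy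
  have hd := mdifferentiableWithinAt_extChartAt_symm (I := J) hy
  rw [chartField, mpullbackWithin_apply]
  rw [J.range_eq_univ] at hinv hd ⊢
  rw [mfderivWithin_univ] at hinv ⊢
  rw [mdifferentiableWithinAt_univ] at hd
  have h1 := mfderiv_comp y hf hd
  rw [mfderiv_eq_fderiv] at h1
  obtain ⟨e, he⟩ := hinv
  rw [← he] at h1 ⊢
  rw [ContinuousLinearMap.inverse_equiv]
  have h2 := congrArg (fun L => L (e.symm (X ((extChartAt J p).symm y)))) h1
  refine h2.trans ?_
  show mfderiv J 𝓘(ℝ, F) f ((extChartAt J p).symm y) (e (e.symm _)) = _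
  rw [e.apply_symm_apply]
  rfl

/-- The tangent space at `p` is identified with `W` by the preferred chart at `p`, so the
differential of that chart at `p` is the identity and no correction appears. -/
theorem mlieBracket_eq_lieBracket_chartField [J.Boundaryless] [IsManifold J ∞ N]
    (X Y : (q : N) → TangentSpace J q) (p : N) :
    mlieBracket J X Y p =
      (lieBracket ℝ (chartField J p X) (chartField J p Y) (extChartAt J p p) : W) := by
  have h0 : mfderiv J 𝓘(ℝ, W) (extChartAt J p) p = ContinuousLinearMap.id ℝ W := by
    refine HasMFDerivAt.mfderiv (f' := ContinuousLinearMap.id ℝ W) ?_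
    refine hasMFDerivAt_iff_hasFDerivAt_chart.2 ⟨continuousAt_extChartAt p, ?_⟩
    refine (hasFDerivAt_id (𝕜 := ℝ) (extChartAt J p p)).congr_of_eventuallyEq ?_
    filter_upwards [extChartAt_target_mem_nhds (I := J) p] with y hy
    exact (extChartAt J p).right_inv hy
  have h1 : mlieBracket J X Y p = (mfderiv J 𝓘(ℝ, W) (extChartAt J p) p : W →L[ℝ] W).inverse
      ((lieBracketWithin ℝ (chartField J p X) (chartField J p Y)
        ((extChartAt J p).symm ⁻¹' univ ∩ range J) (extChartAt J p p) : W)) := rfl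
  have h2 : (mfderiv J 𝓘(ℝ, W) (extChartAt J p) p : W →L[ℝ] W).inverse =
      ContinuousLinearMap.id ℝ W := by
    rw [← ContinuousLinearMap.inverse_id (R := ℝ) (M := W)]
    exact congrArg _ h0
  rw [h1, h2, preimage_univ, J.range_eq_univ, univ_inter, lieBracketWithin_univ]
  rfl

/-- Read in the chart at `p`, this is the vector space identity, where the symmetric second
derivative of `f` drops out. -/
theorem fieldDeriv_mlieBracket [J.Boundaryless] [IsManifold J ∞ N] [CompleteSpace W]
    {f : N → F} {p : N} (hf : ContMDiffAt J 𝓘(ℝ, F) ∞ f p) {X Y : (q : N) → TangentSpace J q}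
    (hX : SmoothFieldAt J X p) (hY : SmoothFieldAt J Y p)
    (hfX : MDifferentiableAt J 𝓘(ℝ, F) (fieldDeriv J f X) p)
    (hfY : MDifferentiableAt J 𝓘(ℝ, F) (fieldDeriv J f Y) p) :
    fieldDeriv J f (mlieBracket J X Y) p =
      fieldDeriv J (fieldDeriv J f Y) X p - fieldDeriv J (fieldDeriv J f X) Y p := by
  have : IsManifold J 2 N := IsManifold.of_le (n := ∞) two_le_infty
  set c := extChartAt J p with hc
  have hcp : c.symm (c p) = p := extChartAt_to_inv p
  have key : ∀ (Z : (q : N) → TangentSpace J q) (g : N → F), MDifferentiableAt J 𝓘(ℝ, F) g p →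
      fderiv ℝ (g ∘ c.symm) (c p) (chartField J p Z (c p)) =
        fieldDeriv J g Z p := by
    intro Z g hg
    rw [fderiv_comp_extChartAt_symm_apply Z (mem_extChartAt_target p)
      (by rw [← hc, hcp]; exact hg)]
    exact congrArg (fieldDeriv J g Z) hcp
  -- An equality of germs is needed, since both sides are differentiated once more.
  have hev : ∀ (Z : (q : N) → TangentSpace J q),
      (fun y => fderiv ℝ (f ∘ c.symm) y (chartField J p Z y))
        =ᶠ[𝓝 (c p)] (fieldDeriv J f Z) ∘ c.symm := by
    intro Z
    have h1 : ∀ᶠ q in 𝓝 p, ContMDiffAt J 𝓘(ℝ, F) 1 f q :=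
      (contMDiffAt_iff_contMDiffAt_nhds (by simp)).1 (hf.of_le one_le_infty)
    have h2 : Tendsto c.symm (𝓝 (c p)) (𝓝 p) := by
      have := continuousAt_extChartAt_symm (I := J) p
      rwa [ContinuousAt, ← hc, hcp] at this
    filter_upwards [extChartAt_target_mem_nhds (I := J) p, h2.eventually h1] with y hy hy1
    exact fderiv_comp_extChartAt_symm_apply Z hy (hy1.mdifferentiableAt one_ne_zero)
  have hdiff : ∀ (Z : (q : N) → TangentSpace J q), SmoothFieldAt J Z p →
      DifferentiableAt ℝ (chartField J p Z) (c p) := by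
    intro Z hZ
    have := (hZ.mdifferentiableAt (by simp)).mdifferentiableWithinAt (s := univ)
      |>.differentiableWithinAt_mpullbackWithin_vectorField
    have h : DifferentiableWithinAt ℝ (chartField J p Z)
        ((extChartAt J p).symm ⁻¹' univ ∩ range J) (c p) := this
    rwa [preimage_univ, J.range_eq_univ, univ_inter, differentiableWithinAt_univ] at h
  have hsm : ContDiffAt ℝ ∞ (f ∘ c.symm) (c p) := by
    have := (contMDiffAt_iff.1 hf).2
    rw [J.range_eq_univ, contDiffWithinAt_univ] at this
    exact this
  have hfd : vderiv J f p = fderiv ℝ (f ∘ c.symm) (c p) :=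
    (hf.mdifferentiableAt (by simp)).hasFDerivAt_comp_extChartAt_symm.fderiv.symm
  have hlhs : fieldDeriv J f (mlieBracket J X Y) p = fderiv ℝ (f ∘ c.symm) (c p)
      (lieBracket ℝ (chartField J p X) (chartField J p Y) (c p)) := by
    rw [fieldDeriv, hfd, mlieBracket_eq_lieBracket_chartField]
  rw [hlhs, fderiv_apply_lieBracket (n := ∞) hsm (by simpa using two_le_infty) (hdiff Y hY) (hdiff X hX),
    (hev X).fderiv_eq, (hev Y).fderiv_eq, key X _ hfY, key Y _ hfX]

theorem ContMDiffAt.fieldDeriv [IsManifold J ∞ N] {f : N → F} {p : N}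
    (hf : ContMDiffAt J 𝓘(ℝ, F) ∞ f p) {X : (q : N) → TangentSpace J q}
    (hX : SmoothFieldAt J X p) : ContMDiffAt J 𝓘(ℝ, F) ∞ (fieldDeriv J f X) p := by
  have h1 := hf.mfderiv_const (m := ∞) (by simp)
  have h2 := ContMDiffAt.clm_apply_of_inCoordinates h1 hX hf
  exact (contMDiff_snd_tangentBundle_modelSpace F 𝓘(ℝ, F)).contMDiffAt.comp p h2

theorem IsLocalDiffeomorphAt.eventually {f : N → F} {p : N}
    (hf : IsLocalDiffeomorphAt J 𝓘(ℝ, F) ∞ f p) :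
    ∀ᶠ q in 𝓝 p, IsLocalDiffeomorphAt J 𝓘(ℝ, F) ∞ f q := by
  obtain ⟨Φ, hp, hΦ⟩ := hf
  filter_upwards [Φ.open_source.mem_nhds hp] with q hq
  exact ⟨Φ, hq, hΦ⟩

/-- The differential of a local diffeomorphism with values in a vector space. -/
def IsLocalDiffeomorphAt.vderivEquiv {f : N → F} {p : N}
    (hf : IsLocalDiffeomorphAt J 𝓘(ℝ, F) ∞ f p) : W ≃L[ℝ] F :=
  hf.mfderivToContinuousLinearEquiv (by simp)

theorem IsLocalDiffeomorphAt.coe_vderivEquiv {f : N → F} {p : N}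
    (hf : IsLocalDiffeomorphAt J 𝓘(ℝ, F) ∞ f p) :
    (hf.vderivEquiv : W →L[ℝ] F) = vderiv J f p := rfl

theorem IsLocalDiffeomorphAt.vderivEquiv_apply {f : N → F} {p : N}
    (hf : IsLocalDiffeomorphAt J 𝓘(ℝ, F) ∞ f p) (v : W) :
    hf.vderivEquiv v = vderiv J f p v := rfl

/-- Near `p` the field is the pullback under `f` of a field on `F` with smooth components.
Smoothness of fields can thus be checked on components. -/
theorem smoothFieldAt_of_fieldDeriv [IsManifold J ∞ N] [CompleteSpace W]
    {f : N → F} {p : N}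
    (hf : IsLocalDiffeomorphAt J 𝓘(ℝ, F) ∞ f p) {X : (q : N) → TangentSpace J q}
    (hX : ContMDiffAt J 𝓘(ℝ, F) ∞ (fieldDeriv J f X) p) : SmoothFieldAt J X p := by
  have : IsManifold J 1 N := IsManifold.of_le (n := ∞) one_le_infty
  set V : (y : F) → TangentSpace 𝓘(ℝ, F) y := fun y =>
    (fieldDeriv J f X (hf.localInverse y) : F) with hV
  have hinv : hf.localInverse (f p) = p := hf.localInverse_left_inv hf.localInverse_mem_target
  have hVs : ContMDiffAt 𝓘(ℝ, F) 𝓘(ℝ, F).tangent ∞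
      (fun y => (⟨y, V y⟩ : TangentBundle 𝓘(ℝ, F) F)) (f p) := by
    have h0 : ContMDiffAt 𝓘(ℝ, F) 𝓘(ℝ, F) ∞ (fieldDeriv J f X ∘ hf.localInverse) (f p) := by
      refine ContMDiffAt.comp (I' := J) (f p) ?_ hf.localInverse_contMDiffAt
      rw [hinv]
      exact hX
    exact contMDiffAt_vectorSpace_iff_contDiffAt.2 h0.contDiffAt
  have h := ContMDiffAt.mpullback_vectorField_preimage hVs hf.contMDiffAt
    ⟨hf.mfderivToContinuousLinearEquiv (by simp), rfl⟩ (m := ∞) (by simp)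
  refine h.congr_of_eventuallyEq ?_
  filter_upwards [hf.eventually, hf.localInverse_eventuallyEq_left] with q hq hq'
  have h1 : mpullback J 𝓘(ℝ, F) f V q = X q := by
    have h2 : mpullback J 𝓘(ℝ, F) f V q = (vderiv J f q).inverse
      (fieldDeriv J f X (hf.localInverse (f q))) := rfl
    have h3 : hf.localInverse (f q) = q := hq'
    rw [h2, h3, ← hq.coe_vderivEquiv, ContinuousLinearMap.inverse_equiv]
    exact hq.vderivEquiv.symm_apply_apply (X q)
  rw [h1]

theorem vderiv_comp {G : Type*} [NormedAddCommGroup G] [NormedSpace ℝ G] [J.Boundaryless]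
    {h : F → G} {f : N → F} {p : N} (hh : DifferentiableAt ℝ h (f p))
    (hf : MDifferentiableAt J 𝓘(ℝ, F) f p) :
    vderiv J (h ∘ f) p = (fderiv ℝ h (f p)).comp (vderiv J f p) := by
  refine HasMFDerivAt.vderiv_eq (hasMFDerivAt_iff_hasFDerivAt_chart.2
    ⟨hh.continuousAt.comp hf.continuousAt, ?_⟩)
  have h1 : (f ∘ (extChartAt J p).symm) (extChartAt J p p) = f p := by simp
  have h2 := hf.hasFDerivAt_comp_extChartAt_symm
  have h3 := hh.hasFDerivAt
  rw [← h1] at h3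
  have := h3.comp _ h2
  rw [h1] at this
  exact this

theorem vderiv_bilin [J.Boundaryless] {B : N → F →L[ℝ] F →L[ℝ] ℝ} {u v : N → F} {p : N}
    (hB : MDifferentiableAt J 𝓘(ℝ, F →L[ℝ] F →L[ℝ] ℝ) B p)
    (hu : MDifferentiableAt J 𝓘(ℝ, F) u p) (hv : MDifferentiableAt J 𝓘(ℝ, F) v p) (w : W) :
    vderiv J (fun q => B q (u q) (v q)) p w =
      vderiv J B p w (u p) (v p) + B p (vderiv J u p w) (v p) + B p (u p) (vderiv J v p w) := by
  have key := ((hB.hasFDerivAt_comp_extChartAt_symm.clm_apply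
    hu.hasFDerivAt_comp_extChartAt_symm).clm_apply hv.hasFDerivAt_comp_extChartAt_symm)
  have h : HasMFDerivAt J 𝓘(ℝ, ℝ) (fun q => B q (u q) (v q)) p _ :=
    hasMFDerivAt_iff_hasFDerivAt_chart.2 ⟨?_, key⟩
  · rw [h.vderiv_eq]
    simp
    ring
  · exact (hB.continuousAt.clm_apply hu.continuousAt).clm_apply hv.continuousAt

end Calculus

/-! ### Lie and exterior derivatives in coordinates -/

section FlatCoordinates

variable {W : Type*} [NormedAddCommGroup W] [NormedSpace ℝ W] {H : Type*} [TopologicalSpace H]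
  {J : ModelWithCorners ℝ W H} {N : Type*} [TopologicalSpace N] [ChartedSpace H N]
  {F : Type*} [NormedAddCommGroup F] [NormedSpace ℝ F]

theorem Filter.EventuallyEq.vderiv_eq {f g : N → F} {p : N} (h : f =ᶠ[𝓝 p] g) :
    vderiv J f p = vderiv J g p := h.mfderiv_eq

theorem Filter.EventuallyEq.fieldDeriv_eq {f g : N → F} {p : N} (h : f =ᶠ[𝓝 p] g)
    (X : (q : N) → TangentSpace J q) : fieldDeriv J f X p = fieldDeriv J g X p := by
  rw [fieldDeriv, fieldDeriv, h.vderiv_eq]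

variable [J.Boundaryless] [IsManifold J ∞ N]

set_option synthInstance.maxHeartbeats 200000 in
theorem derivAlong_bilin {Φ : N → F} {p : N} (hΦ : ContMDiffAt J 𝓘(ℝ, F) ∞ Φ p)
    {B : F → F →L[ℝ] F →L[ℝ] ℝ} (hB : DifferentiableAt ℝ B (Φ p))
    {b : (q : N) → TangentSpace J q → TangentSpace J q → ℝ}
    (hb : ∀ᶠ q in 𝓝 p, ∀ v w, b q v w = B (Φ q) (vderiv J Φ q v) (vderiv J Φ q w))
    (Z : (q : N) → TangentSpace J q) {X Y : (q : N) → TangentSpace J q}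
    (hX : SmoothFieldAt J X p) (hY : SmoothFieldAt J Y p) :
    derivAlong J Z (fun q => b q (X q) (Y q)) p =
      fderiv ℝ B (Φ p) (fieldDeriv J Φ Z p) (fieldDeriv J Φ X p) (fieldDeriv J Φ Y p)
        + B (Φ p) (fieldDeriv J (fieldDeriv J Φ X) Z p) (fieldDeriv J Φ Y p)
        + B (Φ p) (fieldDeriv J Φ X p) (fieldDeriv J (fieldDeriv J Φ Y) Z p) := by
  have hd := hΦ.mdifferentiableAt (n := ∞) (by simp)
  have hXd := (hΦ.fieldDeriv hX).mdifferentiableAt (n := ∞) (by simp)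
  have hYd := (hΦ.fieldDeriv hY).mdifferentiableAt (n := ∞) (by simp)
  have hBd : MDifferentiableAt J 𝓘(ℝ, F →L[ℝ] F →L[ℝ] ℝ) (B ∘ Φ) p :=
    hB.comp_mdifferentiableAt hd
  have h1 : (fun q => b q (X q) (Y q)) =ᶠ[𝓝 p]
      fun q => (B ∘ Φ) q (fieldDeriv J Φ X q) (fieldDeriv J Φ Y q) := by
    filter_upwards [hb] with q hq
    exact hq _ _
  have h2 : derivAlong J Z (fun q => b q (X q) (Y q)) p =
      vderiv J (fun q => (B ∘ Φ) q (fieldDeriv J Φ X q) (fieldDeriv J Φ Y q)) p (Z p) :=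
    h1.fieldDeriv_eq Z
  rw [h2]
  refine (vderiv_bilin hBd hXd hYd _).trans ?_
  rw [vderiv_comp hB hd]
  rfl

variable [CompleteSpace W]

theorem fieldDeriv_mlieBracket_of_smooth {f : N → F} {p : N}
    (hf : ContMDiffAt J 𝓘(ℝ, F) ∞ f p) {X Y : (q : N) → TangentSpace J q}
    (hX : SmoothFieldAt J X p) (hY : SmoothFieldAt J Y p) :
    vderiv J f p (mlieBracket J X Y p) =
      fieldDeriv J (fieldDeriv J f Y) X p - fieldDeriv J (fieldDeriv J f X) Y p :=
  fieldDeriv_mlieBracket hf hX hY ((hf.fieldDeriv hX).mdifferentiableAt (by simp))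
    ((hf.fieldDeriv hY).mdifferentiableAt (by simp))

/-- The Leibniz terms `ξ (X Φ)` and `ξ (Y Φ)` cancel against the brackets, so `X` and `Y` enter only
through their values at `p`. -/
theorem lieDerivMetric_eq {Φ : N → F} {p : N} (hΦ : ContMDiffAt J 𝓘(ℝ, F) ∞ Φ p)
    {B : F → F →L[ℝ] F →L[ℝ] ℝ} (hB : DifferentiableAt ℝ B (Φ p)) {g : SmoothMetric J N}
    (hg : ∀ᶠ q in 𝓝 p, ∀ v w, g.inner q v w = B (Φ q) (vderiv J Φ q v) (vderiv J Φ q w))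
    {ξ X Y : (q : N) → TangentSpace J q} (hξ : SmoothFieldAt J ξ p)
    (hX : SmoothFieldAt J X p) (hY : SmoothFieldAt J Y p) :
    lieDerivMetric g ξ X Y p =
      fderiv ℝ B (Φ p) (fieldDeriv J Φ ξ p) (fieldDeriv J Φ X p) (fieldDeriv J Φ Y p)
        + B (Φ p) (fieldDeriv J (fieldDeriv J Φ ξ) X p) (fieldDeriv J Φ Y p)
        + B (Φ p) (fieldDeriv J Φ X p) (fieldDeriv J (fieldDeriv J Φ ξ) Y p) := by
  have h0 := hg.self_of_nhds
  unfold lieDerivMetric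
  rw [derivAlong_bilin (b := fun q v w => g.inner q v w) hΦ hB hg ξ hX hY, h0, h0,
    fieldDeriv_mlieBracket_of_smooth hΦ hξ hX, fieldDeriv_mlieBracket_of_smooth hΦ hξ hY,
    map_sub, map_sub, sub_apply]
  simp only [fieldDeriv]
  ring

/-- The six Leibniz terms cancel against the three brackets once antisymmetry aligns their
arguments; only the derivative of `B` survives. -/
theorem extDerivTwoForm_eq {Φ : N → F} {p : N} (hΦ : ContMDiffAt J 𝓘(ℝ, F) ∞ Φ p)
    {B : F → F →L[ℝ] F →L[ℝ] ℝ} (hB : DifferentiableAt ℝ B (Φ p))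
    (halt : ∀ a b, B (Φ p) a b = -B (Φ p) b a)
    {Ω : (q : N) → TangentSpace J q → TangentSpace J q → ℝ}
    (hΩ : ∀ᶠ q in 𝓝 p, ∀ v w, Ω q v w = B (Φ q) (vderiv J Φ q v) (vderiv J Φ q w))
    {X Y Z : (q : N) → TangentSpace J q} (hX : SmoothFieldAt J X p)
    (hY : SmoothFieldAt J Y p) (hZ : SmoothFieldAt J Z p) :
    extDerivTwoForm Ω X Y Z p =
      fderiv ℝ B (Φ p) (fieldDeriv J Φ X p) (fieldDeriv J Φ Y p) (fieldDeriv J Φ Z p)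
        + fderiv ℝ B (Φ p) (fieldDeriv J Φ Y p) (fieldDeriv J Φ Z p) (fieldDeriv J Φ X p)
        + fderiv ℝ B (Φ p) (fieldDeriv J Φ Z p) (fieldDeriv J Φ X p) (fieldDeriv J Φ Y p) := by
  have h0 := hΩ.self_of_nhds
  unfold extDerivTwoForm
  rw [derivAlong_bilin hΦ hB hΩ X hY hZ, derivAlong_bilin hΦ hB hΩ Y hZ hX,
    derivAlong_bilin hΦ hB hΩ Z hX hY, h0, h0, h0,
    fieldDeriv_mlieBracket_of_smooth hΦ hX hY, fieldDeriv_mlieBracket_of_smooth hΦ hY hZ,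
    fieldDeriv_mlieBracket_of_smooth hΦ hZ hX]
  simp only [map_sub, sub_apply]
  rw [halt (fieldDeriv J Φ Y p) (fieldDeriv J (fieldDeriv J Φ Z) X p),
    halt (fieldDeriv J Φ Z p) (fieldDeriv J (fieldDeriv J Φ X) Y p),
    halt (fieldDeriv J Φ X p) (fieldDeriv J (fieldDeriv J Φ Y) Z p)]
  simp only [fieldDeriv]
  ring

omit [IsManifold J ∞ N] [CompleteSpace W] in
theorem fieldDeriv_comp_field {Φ : N → F} {p : N} (hΦ : ContMDiffAt J 𝓘(ℝ, F) ∞ Φ p)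
    {ξ : (q : N) → TangentSpace J q} {η : F → F} (hη : DifferentiableAt ℝ η (Φ p))
    (hξη : fieldDeriv J Φ ξ =ᶠ[𝓝 p] η ∘ Φ) (X : (q : N) → TangentSpace J q) :
    fieldDeriv J (fieldDeriv J Φ ξ) X p = fderiv ℝ η (Φ p) (fieldDeriv J Φ X p) := by
  rw [hξη.fieldDeriv_eq, fieldDeriv, vderiv_comp hη (hΦ.mdifferentiableAt (by simp))]
  rfl

/-- The coordinate field with constant components `a` in the coordinates `Φ`. -/
def coordField (J : ModelWithCorners ℝ W H) (Φ : N → F) (a : F) (q : N) : TangentSpace J q :=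
  (vderiv J Φ q).inverse a

omit [J.Boundaryless] [IsManifold J ∞ N] [CompleteSpace W] in
theorem fieldDeriv_coordField {Φ : N → F} {p : N}
    (hΦ : IsLocalDiffeomorphAt J 𝓘(ℝ, F) ∞ Φ p) (a : F) :
    fieldDeriv J Φ (coordField J Φ a) p = a := by
  have h : fieldDeriv J Φ (coordField J Φ a) p = vderiv J Φ p ((vderiv J Φ p).inverse a) := rfl
  rw [h, ← hΦ.coe_vderivEquiv, ContinuousLinearMap.inverse_equiv]
  exact hΦ.vderivEquiv.apply_symm_apply a

omit [J.Boundaryless] in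
theorem smoothFieldAt_coordField {Φ : N → F} {p : N}
    (hΦ : IsLocalDiffeomorphAt J 𝓘(ℝ, F) ∞ Φ p) (a : F) :
    SmoothFieldAt J (coordField J Φ a) p := by
  refine smoothFieldAt_of_fieldDeriv hΦ ?_
  refine (contMDiffAt_const (c := a)).congr_of_eventuallyEq ?_
  filter_upwards [hΦ.eventually] with q hq
  exact fieldDeriv_coordField hq a

/-- In flat coordinates, the homothety equation for a field is an equation between the components
of the metric and of the field. -/
theorem lieDerivMetric_eq_two_iff {Φ : N → F} {p : N} (hΦ : IsLocalDiffeomorphAt J 𝓘(ℝ, F) ∞ Φ p)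
    {B : F → F →L[ℝ] F →L[ℝ] ℝ} (hB : DifferentiableAt ℝ B (Φ p)) {g : SmoothMetric J N}
    (hg : ∀ᶠ q in 𝓝 p, ∀ v w, g.inner q v w = B (Φ q) (vderiv J Φ q v) (vderiv J Φ q w))
    {ξ : (q : N) → TangentSpace J q} (hξ : SmoothFieldAt J ξ p)
    {η : F → F} (hη : DifferentiableAt ℝ η (Φ p)) (hξη : fieldDeriv J Φ ξ =ᶠ[𝓝 p] η ∘ Φ) :
    (∀ X Y : (q : N) → TangentSpace J q, SmoothFieldAt J X p → SmoothFieldAt J Y p →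
      lieDerivMetric g ξ X Y p = 2 * g.inner p (X p) (Y p)) ↔
    ∀ a b : F, fderiv ℝ B (Φ p) (η (Φ p)) a b + B (Φ p) (fderiv ℝ η (Φ p) a) b
      + B (Φ p) a (fderiv ℝ η (Φ p) b) = 2 * B (Φ p) a b := by
  have h0 := hg.self_of_nhds
  have h1 : fieldDeriv J Φ ξ p = η (Φ p) := hξη.self_of_nhds
  have key : ∀ X Y : (q : N) → TangentSpace J q, SmoothFieldAt J X p → SmoothFieldAt J Y p →
      (lieDerivMetric g ξ X Y p = 2 * g.inner p (X p) (Y p) ↔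
      fderiv ℝ B (Φ p) (η (Φ p)) (fieldDeriv J Φ X p) (fieldDeriv J Φ Y p)
      + B (Φ p) (fderiv ℝ η (Φ p) (fieldDeriv J Φ X p)) (fieldDeriv J Φ Y p)
      + B (Φ p) (fieldDeriv J Φ X p) (fderiv ℝ η (Φ p) (fieldDeriv J Φ Y p)) =
      2 * B (Φ p) (fieldDeriv J Φ X p) (fieldDeriv J Φ Y p)) := by
    intro X Y hX hY
    rw [lieDerivMetric_eq hΦ.contMDiffAt hB hg hξ hX hY, h0,
      fieldDeriv_comp_field hΦ.contMDiffAt hη hξη, fieldDeriv_comp_field hΦ.contMDiffAt hη hξη, h1]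
    rfl
  constructor
  -- Constant-component fields realize arbitrary values `a`, `b` at `p`.
  · intro h a b
    have h2 := (key _ _ (smoothFieldAt_coordField hΦ a) (smoothFieldAt_coordField hΦ b)).1
      (h _ _ (smoothFieldAt_coordField hΦ a) (smoothFieldAt_coordField hΦ b))
    rwa [fieldDeriv_coordField hΦ, fieldDeriv_coordField hΦ] at h2
  · intro h X Y hX hY
    exact (key X Y hX hY).2 (h _ _)

/-- In coordinates where `I` is the constant map `C`, differentiating `C` contributes nothing, and
`L_ξ I = 0` reduces to `C` commuting with the derivative of the components of `ξ`. -/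
theorem mlieBracket_complexStructure {Φ : N → F} {p : N}
    (hΦ : IsLocalDiffeomorphAt J 𝓘(ℝ, F) ∞ Φ p)
    {I : (q : N) → TangentSpace J q →L[ℝ] TangentSpace J q} {C : F →L[ℝ] F}
    (hI : ∀ᶠ q in 𝓝 p, ∀ v : TangentSpace J q, vderiv J Φ q (I q v) = C (vderiv J Φ q v))
    {ξ : (q : N) → TangentSpace J q} (hξ : SmoothFieldAt J ξ p)
    {η : F → F} (hη : DifferentiableAt ℝ η (Φ p)) (hξη : fieldDeriv J Φ ξ =ᶠ[𝓝 p] η ∘ Φ)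
    (hC : ∀ a, fderiv ℝ η (Φ p) (C a) = C (fderiv ℝ η (Φ p) a))
    {X : (q : N) → TangentSpace J q} (hX : SmoothFieldAt J X p) :
    mlieBracket J ξ (fun q => I q (X q)) p = I p (mlieBracket J ξ X p) := by
  have hXs := hΦ.contMDiffAt.fieldDeriv hX
  have h1 : fieldDeriv J Φ (fun q => I q (X q)) =ᶠ[𝓝 p] C ∘ fieldDeriv J Φ X := by
    filter_upwards [hI] with q hq
    exact hq _
  have hIX : SmoothFieldAt J (fun q => I q (X q)) p := by
    refine smoothFieldAt_of_fieldDeriv hΦ (ContMDiffAt.congr_of_eventuallyEq ?_ h1)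
    exact C.contMDiff.contMDiffAt.comp p hXs
  refine hΦ.vderivEquiv.injective ?_
  change vderiv J Φ p (mlieBracket J ξ (fun q => I q (X q)) p) =
    vderiv J Φ p (I p (mlieBracket J ξ X p))
  rw [hI.self_of_nhds, fieldDeriv_mlieBracket_of_smooth hΦ.contMDiffAt hξ hIX,
    fieldDeriv_mlieBracket_of_smooth hΦ.contMDiffAt hξ hX,
    fieldDeriv_comp_field hΦ.contMDiffAt hη hξη, fieldDeriv_comp_field hΦ.contMDiffAt hη hξη,
    h1.fieldDeriv_eq, h1.self_of_nhds, map_sub, Function.comp_apply, hC]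
  congr 1
  rw [fieldDeriv, vderiv_comp C.differentiableAt (hXs.mdifferentiableAt (by simp)),
    ContinuousLinearMap.fderiv]
  rfl

end FlatCoordinates

/-! ### Smoothness of bilinear forms given in coordinates -/

section FlatCoordinates

variable {W : Type*} [NormedAddCommGroup W] [NormedSpace ℝ W] {H : Type*} [TopologicalSpace H]
  {J : ModelWithCorners ℝ W H} {N : Type*} [TopologicalSpace N] [ChartedSpace H N]
  {F : Type*} [NormedAddCommGroup F] [NormedSpace ℝ F]

/-- In the trivialization at `p` the section is `B (Φ q) (D q ·) (D q ·)`, where `D` is the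
coordinate expression of `dΦ`, and `D` is smooth. -/
theorem contMDiffAt_bilin_section [IsManifold J ∞ N] {Φ : N → F} {p : N}
    (hΦ : ContMDiffAt J 𝓘(ℝ, F) ∞ Φ p) {B : F → F →L[ℝ] F →L[ℝ] ℝ}
    (hB : ContDiffAt ℝ ∞ B (Φ p))
    {b : (q : N) → TangentSpace J q →L[ℝ] TangentSpace J q →L[ℝ] ℝ}
    (hb : ∀ᶠ q in 𝓝 p, ∀ v w, b q v w = B (Φ q) (vderiv J Φ q v) (vderiv J Φ q w)) :
    ContMDiffAt J (J.prod 𝓘(ℝ, W →L[ℝ] W →L[ℝ] ℝ)) ∞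
      (fun q => TotalSpace.mk' (W →L[ℝ] W →L[ℝ] ℝ) q (b q)) p := by
  have : IsManifold J 1 N := IsManifold.of_le (n := ∞) one_le_infty
  rw [contMDiffAt_hom_bundle]
  refine ⟨contMDiffAt_id, ?_⟩
  set D : N → W →L[ℝ] F := inTangentCoordinates J 𝓘(ℝ, F) id Φ (mfderiv J 𝓘(ℝ, F) Φ) p with hD
  have h1 : ContMDiffAt J 𝓘(ℝ, W →L[ℝ] F) ∞ D p := hΦ.mfderiv_const (m := ∞) (by simp)
  have h2 : ContMDiffAt J 𝓘(ℝ, F →L[ℝ] F →L[ℝ] ℝ) ∞ (B ∘ Φ) p :=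
    hB.contMDiffAt.comp p hΦ
  have h3 : ContMDiffAt J 𝓘(ℝ, W →L[ℝ] W →L[ℝ] ℝ) ∞
      (fun q => ((D q).precomp ℝ).comp (((B ∘ Φ) q).comp (D q))) p :=
    (ContMDiffAt.clm_precomp (F₃ := ℝ) h1).clm_comp (h2.clm_comp h1)
  refine h3.congr_of_eventuallyEq ?_
  have hbase : ∀ᶠ q in 𝓝 p, q ∈ (trivializationAt W (TangentSpace J) p).baseSet :=
    (trivializationAt W (TangentSpace J) p).open_baseSet.mem_nhds
      (FiberBundle.mem_baseSet_trivializationAt' p)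
  filter_upwards [hb, hbase] with q hq hq'
  ext v w
  have hDq : ∀ v : W, D q v = vderiv J Φ q ((trivializationAt W (TangentSpace J) p).symm q v) := by
    intro v
    have h4 : D q v = (trivializationAt F (TangentSpace 𝓘(ℝ, F)) (Φ p)).continuousLinearMapAt ℝ (Φ q)
      (mfderiv J 𝓘(ℝ, F) Φ q ((trivializationAt W (TangentSpace J) p).symmL ℝ q v)) := rfl
    rw [h4]
    have h5 := TangentBundle.continuousLinearMapAt_model_space (𝕜 := ℝ) (Φ p) (Φ q)
    rw [h5, Trivialization.symmL_apply _ hq']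
    rfl
  refine (inCoordinates_apply_eq₂ hq' hq' (mem_univ _)).trans ?_
  have h4 : ∀ r : ℝ, (trivializationAt ℝ (Bundle.Trivial N ℝ) p).linearMapAt ℝ q r = r :=
    fun r => congrArg (fun L => L r) (Bundle.Trivial.linearMapAt_trivialization ℝ N ℝ q)
  refine (h4 _).trans ?_
  rw [hq]
  simp [hDq]

end FlatCoordinates

/-! ### Affine transitions and the covering of development germs -/

section AffineAtlas

variable {V : Type*} [NormedAddCommGroup V] [NormedSpace ℝ V]

theorem ContinuousAffineMap.analyticOnNhd (A : V →ᴬ[ℝ] V) (s : Set V) :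
    AnalyticOnNhd ℝ A s := by
  have h : (A : V → V) = fun x => A.contLinear x + A 0 := by
    ext1 x
    exact congrFun A.decomp x
  rw [h]
  exact fun x _ => (A.contLinear.analyticAt x).add analyticAt_const

/-- The identity theorem for analytic maps. This rigidity makes transitions unique, locally constant
and invertible. -/
theorem ContinuousAffineMap.eq_of_eventuallyEq {A B : V →ᴬ[ℝ] V} {x : V}
    (h : ∀ᶠ y in 𝓝 x, A y = B y) : A = B :=
  DFunLike.coe_injective
    ((A.analyticOnNhd univ).eq_of_eventuallyEq (B.analyticOnNhd univ) h)

theorem ContinuousAffineEquiv.eq_of_eventuallyEq {A B : V ≃ᴬ[ℝ] V} {x : V}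
    (h : ∀ᶠ y in 𝓝 x, A y = B y) : A = B :=
  ContinuousAffineEquiv.toContinuousAffineMap_injective
    (ContinuousAffineMap.eq_of_eventuallyEq (A := A.toContinuousAffineMap)
      (B := B.toContinuousAffineMap) h)

/-- Mutually inverse affine maps, as an affine equivalence. -/
def ContinuousAffineEquiv.ofInverse (A B : V →ᴬ[ℝ] V) (h₁ : ∀ x, B (A x) = x)
    (h₂ : ∀ x, A (B x) = x) : V ≃ᴬ[ℝ] V where
  toFun := A
  invFun := B
  left_inv := h₁
  right_inv := h₂
  linear := LinearEquiv.ofLinearMap A.linear B.linear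
    (by
      have : (A.toAffineMap.comp B.toAffineMap) = AffineMap.id ℝ V := by
        ext x; exact h₂ x
      have := congrArg AffineMap.linear this
      simpa using this)
    (by
      have : (B.toAffineMap.comp A.toAffineMap) = AffineMap.id ℝ V := by
        ext x; exact h₁ x
      have := congrArg AffineMap.linear this
      simpa using this)
  map_vadd' p v := A.map_vadd p v
  continuous_toFun := A.continuous
  continuous_invFun := B.continuous

variable {M : Type*} [TopologicalSpace M]

theorem OpenPartialHomeomorph.eventually_nhds_image {X Y : Type*} [TopologicalSpace X]
    [TopologicalSpace Y] (e : OpenPartialHomeomorph X Y) {x : X} (hx : x ∈ e.source) {P : Y → Prop} :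
    (∀ᶠ y in 𝓝 (e x), P y) ↔ ∀ᶠ z in 𝓝 x, P (e z) := by
  rw [← e.map_nhds_eq hx, eventually_map]

open Classical in
/-- The affine equivalence `T` such that `e' = T ∘ e` near `x`. -/
def affineTransition (e e' : OpenPartialHomeomorph M V) (x : M) : V ≃ᴬ[ℝ] V :=
  if h : ∃ T : V ≃ᴬ[ℝ] V, ∀ᶠ y in 𝓝 x, e' y = T (e y) then h.choose
  else ContinuousAffineEquiv.refl ℝ V

theorem affineTransition_eq {e e' : OpenPartialHomeomorph M V} {x : M} (hx : x ∈ e.source)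
    {T : V ≃ᴬ[ℝ] V} (hT : ∀ᶠ y in 𝓝 x, e' y = T (e y)) : affineTransition e e' x = T := by
  have h : ∃ T : V ≃ᴬ[ℝ] V, ∀ᶠ y in 𝓝 x, e' y = T (e y) := ⟨T, hT⟩
  rw [affineTransition, dif_pos h]
  refine ContinuousAffineEquiv.eq_of_eventuallyEq ((e.eventually_nhds_image hx).2 ?_)
  filter_upwards [hT, h.choose_spec] with y h1 h2
  rw [← h1, ← h2]

variable [ChartedSpace V M]

theorem exists_affine_transition {e e' : OpenPartialHomeomorph M V}
    (he : e ∈ (affineGroupoid V).maximalAtlas M) (he' : e' ∈ (affineGroupoid V).maximalAtlas M)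
    {x : M} (hx : x ∈ e.source) (hx' : x ∈ e'.source) :
    ∃ A : V →ᴬ[ℝ] V, ∀ᶠ y in 𝓝 x, e' y = A (e y) := by
  have h := StructureGroupoid.compatible_of_mem_maximalAtlas he he'
  have h1 := (mem_groupoid_of_pregroupoid.1 h).1
  obtain ⟨A, hA⟩ := h1 (e x) (by simp [hx, hx'])
  refine ⟨A, ?_⟩
  filter_upwards [(e.eventually_nhds_image hx).1 hA, e.open_source.mem_nhds hx] with y hy hys
  simpa [e.left_inv hys] using hy

theorem exists_affineEquiv_transition {e e' : OpenPartialHomeomorph M V}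
    (he : e ∈ (affineGroupoid V).maximalAtlas M) (he' : e' ∈ (affineGroupoid V).maximalAtlas M)
    {x : M} (hx : x ∈ e.source) (hx' : x ∈ e'.source) :
    ∃ T : V ≃ᴬ[ℝ] V, ∀ᶠ y in 𝓝 x, e' y = T (e y) := by
  obtain ⟨A, hA⟩ := exists_affine_transition he he' hx hx'
  obtain ⟨B, hB⟩ := exists_affine_transition he' he hx' hx
  have h1 : B.comp A = ContinuousAffineMap.id ℝ V := by
    refine ContinuousAffineMap.eq_of_eventuallyEq ((e.eventually_nhds_image hx).2 ?_)
    filter_upwards [hA, hB] with y h1 h2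
    simp [← h1, ← h2]
  have h2 : A.comp B = ContinuousAffineMap.id ℝ V := by
    refine ContinuousAffineMap.eq_of_eventuallyEq ((e'.eventually_nhds_image hx').2 ?_)
    filter_upwards [hA, hB] with y h1 h2
    simp [← h1, ← h2]
  exact ⟨ContinuousAffineEquiv.ofInverse A B (fun x => congrArg (fun L => L x) h1)
    (fun x => congrArg (fun L => L x) h2), hA⟩

variable [HasGroupoid M (affineGroupoid V)]

theorem eventually_affineTransition {e e' : OpenPartialHomeomorph M V}
    (he : e ∈ atlas V M) (he' : e' ∈ atlas V M) {x : M} (hx : x ∈ e.source)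
    (hx' : x ∈ e'.source) : ∀ᶠ y in 𝓝 x, e' y = affineTransition e e' x (e y) := by
  obtain ⟨T, hT⟩ := exists_affineEquiv_transition
    ((affineGroupoid V).subset_maximalAtlas he) ((affineGroupoid V).subset_maximalAtlas he') hx hx'
  rw [affineTransition_eq hx hT]
  exact hT

variable (V) in
/-- The affine equivalences of `V`, as a discrete space: the germs of development maps. -/
def DevelopmentGerm := V ≃ᴬ[ℝ] V

instance : TopologicalSpace (DevelopmentGerm V) := ⊥

instance : DiscreteTopology (DevelopmentGerm V) := ⟨rfl⟩

variable (V M) in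
/-- The bundle of germs of development maps; `a` stands, over the chart `e`, for `a ∘ e`. -/
def developmentBundle : FiberBundleCore (atlas V M) M (DevelopmentGerm V) where
  baseSet e := e.1.source
  isOpen_baseSet e := e.1.open_source
  indexAt := achart V
  mem_baseSet_at x := mem_chart_source V x
  -- If `e = T ∘ e'` then `a ∘ e = (a ∘ T) ∘ e'`: germs change by precomposition.
  coordChange e e' x a := ContinuousAffineEquiv.trans (affineTransition e'.1 e.1 x) a
  coordChange_self e x hx a := by
    rw [affineTransition_eq hx (T := ContinuousAffineEquiv.refl ℝ V)
      (Eventually.of_forall fun y => rfl)]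
    exact ContinuousAffineEquiv.refl_trans _
  continuousOn_coordChange e e' := by
    rintro ⟨x, a⟩ ⟨⟨hx, hx'⟩, -⟩
    -- The relation defining the transition at `x` also holds near every nearby point, where
    -- uniqueness gives the same map.
    have h1 : ∀ᶠ y in 𝓝 x, affineTransition e'.1 e.1 y = affineTransition e'.1 e.1 x := by
      filter_upwards [(eventually_affineTransition e'.2 e.2 hx' hx).eventually_nhds,
        e'.1.open_source.mem_nhds hx'] with y hy hys
      exact affineTransition_eq hys hy
    have h2 : ∀ᶠ z : M × DevelopmentGerm V in 𝓝 (x, a),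
        ContinuousAffineEquiv.trans (affineTransition e'.1 e.1 x) a =
        ContinuousAffineEquiv.trans (affineTransition e'.1 e.1 z.1) z.2 := by
      rw [nhds_prod_eq, nhds_discrete (DevelopmentGerm V)]
      filter_upwards [h1.prod_mk (eventually_pure.2 (rfl : a = a))] with z hz
      rw [hz.1, hz.2]
    exact ((continuousAt_const (y := (show DevelopmentGerm V from
      ContinuousAffineEquiv.trans (affineTransition e'.1 e.1 x) a))).congr h2).continuousWithinAt
  coordChange_comp e e' e'' x hx a := by
    have h1 := eventually_affineTransition e'.2 e.2 hx.1.2 hx.1.1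
    have h2 := eventually_affineTransition e''.2 e'.2 hx.2 hx.1.2
    have h3 : affineTransition e''.1 e.1 x =
        (affineTransition e''.1 e'.1 x).trans (affineTransition e'.1 e.1 x) := by
      refine affineTransition_eq hx.2 ?_
      filter_upwards [h1, h2] with y h1 h2
      rw [ContinuousAffineEquiv.trans_apply, ← h2, ← h1]
    rw [h3]
    rfl

/-- Trivial monodromy: the identity of `M` lifts to the covering of germs, and evaluating at each
point the germ chosen there gives the map. -/
theorem exists_locally_affineEquiv_comp_chart [LocallyPathConnectedSpace V]
    [SimplyConnectedSpace M] : ∃ dev : M → V, ∀ p : M, ∃ a : V ≃ᴬ[ℝ] V,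
      ∀ᶠ q in 𝓝 p, dev q = a (chartAt V p q) := by
  have : LocallyPathConnectedSpace M := ChartedSpace.locallyPathConnectedSpace V M
  set Z := developmentBundle V M with hZ
  have hcov : IsCoveringMap (π (DevelopmentGerm V) Z.Fiber) := FiberBundle.isCoveringMap
  obtain ⟨m⟩ : Nonempty M := inferInstance
  obtain ⟨s, ⟨-, hs⟩, -⟩ := hcov.existsUnique_continuousMap_lifts (ContinuousMap.id M) m
    (⟨m, (ContinuousAffineEquiv.refl ℝ V : DevelopmentGerm V)⟩ : Z.TotalSpace) rfl
  have hs' : ∀ q, (s q).proj = q := fun q => congrFun hs q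
  -- The fibre coordinate `(s q).2` refers to the chart at `(s q).proj`, a point equal to `q`.
  refine ⟨fun q => (show V ≃ᴬ[ℝ] V from (s q).2) (chartAt V (s q).proj q), fun p => ?_⟩
  set c := chartAt V p with hc
  have hcont : ContinuousAt (fun q => (Z.localTriv (achart V p) (s q)).2) p := by
    refine continuousAt_snd.comp (f := fun q => Z.localTriv (achart V p) (s q))
      (ContinuousAt.comp (g := Z.localTriv (achart V p)) ?_ s.continuous.continuousAt)
    refine (Z.localTriv (achart V p)).continuousAt ?_
    rw [Trivialization.mem_source]
    show (s p).proj ∈ (chartAt V p).source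
    rw [hs' p]
    exact mem_chart_source V p
  -- A continuous map to the discrete fibre is locally constant; its value is the required affine
  -- equivalence.
  have hev : ∀ᶠ q in 𝓝 p, (Z.localTriv (achart V p) (s q)).2 =
      (Z.localTriv (achart V p) (s p)).2 := by
    have := hcont.tendsto
    rw [nhds_discrete (DevelopmentGerm V), tendsto_pure] at this
    exact this
  refine ⟨(Z.localTriv (achart V p) (s p)).2, ?_⟩
  filter_upwards [hev, c.open_source.mem_nhds (mem_chart_source V p)] with q hq hqs
  have hmem : (s q).proj ∈ c.source := by rw [hs' q]; exact hqs
  have h1 := (eventually_affineTransition (chart_mem_atlas V p) (chart_mem_atlas V (s q).proj)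
    hmem (mem_chart_source V (s q).proj)).self_of_nhds
  have h2 : chartAt V (s q).proj q = chartAt V (s q).proj (s q).proj := by rw [hs' q]
  have h3 : c (s q).proj = c q := by rw [hs' q]
  have h4 : (Z.localTriv (achart V p) (s q)).2 = ContinuousAffineEquiv.trans
      (affineTransition c (chartAt V (s q).proj) (s q).proj) (s q).2 := rfl
  rw [← hq, h4, h2, h1]
  show _ = (show V ≃ᴬ[ℝ] V from (s q).2) _
  rw [← h3]
  rfl

end AffineAtlas

/-! ### From local affine equivalences to development maps -/

section LocalDiffeomorph

variable {E : Type*} [NormedAddCommGroup E] [NormedSpace ℝ E] {H : Type*} [TopologicalSpace H]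
  {J : ModelWithCorners ℝ E H} {N : Type*} [TopologicalSpace N] [ChartedSpace H N]
  {E' : Type*} [NormedAddCommGroup E'] [NormedSpace ℝ E'] {H' : Type*} [TopologicalSpace H']
  {J' : ModelWithCorners ℝ E' H'} {N' : Type*} [TopologicalSpace N'] [ChartedSpace H' N']

theorem OpenPartialHomeomorph.isLocalDiffeomorphAt_of_eventuallyEq
    (e : OpenPartialHomeomorph N N') (h₁ : ContMDiffOn J J' ∞ e e.source)
    (h₂ : ContMDiffOn J' J ∞ e.symm e.target) {p : N} (hp : p ∈ e.source) {f : N → N'}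
    (hf : f =ᶠ[𝓝 p] e) : IsLocalDiffeomorphAt J J' ∞ f p := by
  obtain ⟨U, hU, hUo, hpU⟩ := eventually_nhds_iff.1 hf
  set e' := e.restrOpen U hUo with he'
  have hs : e'.source = e.source ∩ U := e.restrOpen_source U hUo
  have ht : e'.target ⊆ e.target := fun y hy => by
    have := e'.map_target hy
    rw [hs] at this
    have h3 := e.map_source this.1
    have h4 : e (e'.symm y) = y := e'.right_inv hy
    rwa [h4] at h3
  exact ⟨⟨e'.toPartialEquiv, e'.open_source, e'.open_target,
    h₁.mono (hs ▸ inter_subset_left), h₂.mono ht⟩, by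
      show p ∈ e'.source
      rw [hs]; exact ⟨hp, hpU⟩, fun x hx => by
      have hx' : x ∈ e'.source := hx
      rw [hs] at hx'
      exact hU x hx'.2⟩

end LocalDiffeomorph

section Development

variable {V : Type*} [NormedAddCommGroup V] [NormedSpace ℝ V]
  {M : Type*} [TopologicalSpace M] [ChartedSpace V M] [HasGroupoid M (affineGroupoid V)]

theorem isDevelopmentMap_of_locally {dev : M → V} (h : ∀ p : M, ∃ a : V ≃ᴬ[ℝ] V,
    ∀ᶠ q in 𝓝 p, dev q = a (chartAt V p q)) : IsDevelopmentMap dev := by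
  constructor
  · intro p
    obtain ⟨a, ha⟩ := h p
    refine OpenPartialHomeomorph.isLocalDiffeomorphAt_of_eventuallyEq
      ((chartAt V p).transHomeomorph a.toHomeomorph) ?_ ?_ (mem_chart_source V p) ha
    · have h1 : ContMDiff 𝓘(ℝ, V) 𝓘(ℝ, V) ∞ a := a.toContinuousAffineMap.contDiff.contMDiff
      exact h1.comp_contMDiffOn (contMDiffOn_chart (I := 𝓘(ℝ, V)) (x := p))
    · have h1 : ContMDiff 𝓘(ℝ, V) 𝓘(ℝ, V) ∞ a.symm :=
        a.symm.toContinuousAffineMap.contDiff.contMDiff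
      exact (contMDiffOn_chart_symm (I := 𝓘(ℝ, V)) (x := p)).comp h1.contMDiffOn
        (fun y hy => hy)
  · intro p
    obtain ⟨a, ha⟩ := h p
    refine ⟨?_, a.toContinuousAffineMap, ?_⟩
    · have h1 : ContinuousAt (chartAt V p) p :=
        (chartAt V p).continuousAt (mem_chart_source V p)
      exact (a.continuous.continuousAt.comp h1).congr (ha.mono fun q hq => hq.symm)
    · exact ha

theorem exists_isDevelopmentMap [SimplyConnectedSpace M] :
    ∃ dev : M → V, IsDevelopmentMap dev := by
  obtain ⟨dev, h⟩ := exists_locally_affineEquiv_comp_chart (V := V) (M := M)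
  exact ⟨dev, isDevelopmentMap_of_locally h⟩

end Development

/-! ### The image of an affine field under a development map -/

section AffineFields

variable {V : Type*} [NormedAddCommGroup V] [NormedSpace ℝ V] [FiniteDimensional ℝ V]

/-- The functions on a set that are restrictions of affine maps. -/
def affineFunctionsOn (B : Set V) : Submodule ℝ (B → V) :=
  LinearMap.range
    ({ toFun := fun z y => z.1 y + z.2
       map_add' := fun z w => by ext1 y; simp; abel
       map_smul' := fun r z => by ext1 y; simp } : (V →L[ℝ] V) × V →ₗ[ℝ] (B → V))

omit [FiniteDimensional ℝ V] in
theorem mem_affineFunctionsOn {B : Set V} {f : B → V} :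
    f ∈ affineFunctionsOn B ↔ ∃ A : V →ᴬ[ℝ] V, ∀ y : B, f y = A y := by
  constructor
  · rintro ⟨⟨L, c⟩, rfl⟩
    exact ⟨L.toContinuousAffineMap + ContinuousAffineMap.const ℝ V c, fun y => rfl⟩
  · rintro ⟨A, hA⟩
    refine ⟨(A.contLinear, A 0), ?_⟩
    ext1 y
    rw [hA]
    exact (congrFun A.decomp y.1).symm

/-- A finite-dimensional subspace is closed; in the product topology this says that a pointwise
limit of affine functions is affine. -/
theorem isClosed_affineFunctionsOn (B : Set V) : IsClosed (affineFunctionsOn B : Set (B → V)) := by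
  have : FiniteDimensional ℝ (affineFunctionsOn B) := by
    unfold affineFunctionsOn
    infer_instance
  exact Submodule.closed_of_finiteDimensional _

theorem exists_inverse_of_surjective_contLinear (C : V →ᴬ[ℝ] V)
    (hC : Function.Surjective C.contLinear) : ∃ T : V ≃ᴬ[ℝ] V, ∀ y, T y = C y := by
  have hinj : Function.Injective C.contLinear :=
    (LinearMap.injective_iff_surjective (f := (C.contLinear : V →ₗ[ℝ] V))).2 hC
  let L : V ≃L[ℝ] V := (LinearEquiv.ofBijective (C.contLinear : V →ₗ[ℝ] V)
    ⟨hinj, hC⟩).toContinuousLinearEquiv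
  have hL : ∀ v, L v = C.contLinear v := fun v => rfl
  let D : V →ᴬ[ℝ] V := (L.symm : V →L[ℝ] V).toContinuousAffineMap +
    ContinuousAffineMap.const ℝ V (-L.symm (C 0))
  have hD : ∀ y, D y = L.symm (y - C 0) := by
    intro y
    rw [map_sub, sub_eq_add_neg]
    rfl
  have hdec : ∀ x, C x = C.contLinear x + C 0 := congrFun C.decomp
  refine ⟨ContinuousAffineEquiv.ofInverse C D (fun x => ?_) (fun x => ?_), fun y => rfl⟩
  · rw [hD, hdec x, add_sub_cancel_right, ← hL, L.symm_apply_apply]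
  · rw [hD, hdec, ← hL, L.apply_symm_apply, sub_add_cancel]

variable {M : Type*} [TopologicalSpace M] [ChartedSpace V M] [HasGroupoid M (affineGroupoid V)]

/-- The definition yields an affine map only; it is invertible because the differential of `dev` is
onto and the dimension is finite. -/
theorem IsDevelopmentMap.exists_affineEquiv_comp {dev : M → V} (hdev : IsDevelopmentMap dev)
    {e : OpenPartialHomeomorph M V} (he : e ∈ (affineGroupoid V).maximalAtlas M) {x : M}
    (hx : x ∈ e.source) : ∃ T : V ≃ᴬ[ℝ] V, ∀ᶠ y in 𝓝 x, dev y = T (e y) := by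
  obtain ⟨A, hA⟩ := (hdev.2 x).2
  have hA' : ∀ᶠ y in 𝓝 x, dev y = A (chartAt V x y) := hA
  obtain ⟨B, hB⟩ := exists_affine_transition he
    ((affineGroupoid V).chart_mem_maximalAtlas x) hx (mem_chart_source V x)
  have hC : ∀ᶠ y in 𝓝 x, dev y = A.comp B (e y) := by
    filter_upwards [hA', hB] with y h1 h2
    rw [h1, h2]
    rfl
  have hes : e ∈ IsManifold.maximalAtlas 𝓘(ℝ, V) ∞ M :=
    StructureGroupoid.maximalAtlas_mono (affineGroupoid_le_contDiffGroupoid V) he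
  have hed : MDifferentiableAt 𝓘(ℝ, V) 𝓘(ℝ, V) e x :=
    (contMDiffAt_of_mem_maximalAtlas hes hx).mdifferentiableAt (by simp)
  have hd : vderiv 𝓘(ℝ, V) dev x = (A.comp B).contLinear.comp (vderiv 𝓘(ℝ, V) e x) := by
    have h1 : dev =ᶠ[𝓝 x] A.comp B ∘ e := hC
    rw [h1.vderiv_eq, vderiv_comp (A.comp B).differentiable.differentiableAt hed,
      (A.comp B).fderiv]
  obtain ⟨T, hT⟩ := exists_inverse_of_surjective_contLinear (A.comp B) (by
    intro w
    obtain ⟨v, hv⟩ := (hdev.1 x).vderivEquiv.surjective w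
    rw [(hdev.1 x).vderivEquiv_apply, hd] at hv
    exact ⟨_, hv⟩)
  refine ⟨T, ?_⟩
  filter_upwards [hC] with y hy
  rw [hy, hT]

theorem IsAffineAt.exists_comp_dev {dev : M → V} (hdev : IsDevelopmentMap dev) {f : M → M} {q : M}
    (hf : IsAffineAt V f q) : ∃ A : V →ᴬ[ℝ] V, ∀ᶠ z in 𝓝 q, dev (f z) = A (dev z) := by
  obtain ⟨hcont, A, hA⟩ := hf
  obtain ⟨T, hT⟩ := hdev.exists_affineEquiv_comp
    ((affineGroupoid V).chart_mem_maximalAtlas (f q)) (mem_chart_source V (f q))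
  obtain ⟨S, hS⟩ := hdev.exists_affineEquiv_comp
    ((affineGroupoid V).chart_mem_maximalAtlas q) (mem_chart_source V q)
  refine ⟨T.toContinuousAffineMap.comp (A.comp S.symm.toContinuousAffineMap), ?_⟩
  filter_upwards [hcont.eventually hT, hA, hS] with z h1 h2 h3
  rw [h1, h2, h3]
  show _ = T (A (S.symm (S _)))
  rw [S.symm_apply_apply]

omit [FiniteDimensional ℝ V] [HasGroupoid M (affineGroupoid V)] in
theorem IsDevelopmentMap.map_nhds {dev : M → V} (hdev : IsDevelopmentMap dev) (p : M) :
    (𝓝 p).map dev = 𝓝 (dev p) :=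
  hdev.1.isLocalHomeomorph.map_nhds_eq p

omit [FiniteDimensional ℝ V] [HasGroupoid M (affineGroupoid V)] in
theorem IsDevelopmentMap.affine_unique {dev : M → V} (hdev : IsDevelopmentMap dev) {p : M}
    {A B : V →ᴬ[ℝ] V} (h : ∀ᶠ q in 𝓝 p, A (dev q) = B (dev q)) : A = B := by
  refine ContinuousAffineMap.eq_of_eventuallyEq (x := dev p) ?_
  rw [← hdev.map_nhds p]
  exact h

theorem IsAffineField.exists_locally {dev : M → V} (hdev : IsDevelopmentMap dev)
    {ξ : (p : M) → TangentSpace 𝓘(ℝ, V) p} (hξ : IsAffineField ξ) (p : M) :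
    ∃ η : V →ᴬ[ℝ] V, ∀ᶠ q in 𝓝 p, fieldDeriv 𝓘(ℝ, V) dev ξ q = η (dev q) := by
  obtain ⟨U, hU, hpU, ε, hε, φ, -, hφ, haff⟩ := hξ p
  have hloc := hdev.1 p
  let ψ : V → M := fun y => hloc.localInverse y
  have hψp : ψ (dev p) = p := hloc.localInverse_left_inv hloc.localInverse_mem_target
  have hψc : ∀ᶠ y in 𝓝 (dev p), ContinuousAt ψ y ∧ ψ y ∈ U ∧ dev (ψ y) = y := by
    have h1 := hloc.localInverse_open_source.mem_nhds hloc.localInverse_mem_source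
    have h2 : ContinuousAt ψ (dev p) := hloc.localInverse_contMDiffAt.continuousAt
    have h3 : ∀ᶠ y in 𝓝 (dev p), ψ y ∈ U :=
      h2.eventually (by rw [hψp]; exact hU.mem_nhds hpU)
    filter_upwards [h1, h3] with y hy hyU
    exact ⟨(hloc.contmdiffOn_localInverse.continuousOn y hy).continuousAt
      (hloc.localInverse_open_source.mem_nhds hy), hyU, hloc.localInverse_right_inv hy⟩
  obtain ⟨r, hr, hB⟩ := Metric.eventually_nhds_iff_ball.1 hψc
  set B := Metric.ball (dev p) r with hBdef
  -- The ball must not depend on `t`, so that a limit can be taken. On it the flow is locally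
  -- affine, hence analytic, hence a single affine map by the identity theorem.
  have hflow : ∀ t ∈ Ioo (-ε) ε, ∃ A : V →ᴬ[ℝ] V, ∀ y ∈ B, dev (φ t (ψ y)) = A y := by
    intro t ht
    have hl : ∀ y ∈ B, ∃ A : V →ᴬ[ℝ] V, (fun y => dev (φ t (ψ y))) =ᶠ[𝓝 y] A := by
      intro y hy
      obtain ⟨hc, hyU, -⟩ := hB y hy
      obtain ⟨A, hA⟩ := (haff t ht (ψ y) hyU).exists_comp_dev hdev
      refine ⟨A, ?_⟩
      filter_upwards [hc.eventually hA, Metric.isOpen_ball.mem_nhds hy] with z hz hzB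
      rw [hz, (hB z hzB).2.2]
    obtain ⟨A, hA⟩ := hl (dev p) (Metric.mem_ball_self hr)
    refine ⟨A, ?_⟩
    refine AnalyticOnNhd.eqOn_of_preconnected_of_eventuallyEq ?_ (A.analyticOnNhd B)
      (convex_ball _ _).isPreconnected (Metric.mem_ball_self hr) hA
    intro y hy
    obtain ⟨A', hA'⟩ := hl y hy
    exact (A'.analyticOnNhd univ y (mem_univ _)).congr hA'.symm
  have hderiv : ∀ y ∈ B, HasDerivAt (fun t => dev (φ t (ψ y)))
      (fieldDeriv 𝓘(ℝ, V) dev ξ (ψ y)) 0 := by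
    intro y hy
    obtain ⟨-, hyU, -⟩ := hB y hy
    obtain ⟨h0, hint⟩ := hφ (ψ y) hyU
    have h1 := (hint 0 ⟨by linarith, hε⟩).hasMFDerivAt (Ioo_mem_nhds (by linarith) hε)
    have h2 := ((hdev.1 (φ 0 (ψ y))).mdifferentiableAt (by simp)).hasMFDerivAt.comp 0 h1
    have h3 : ∀ (D : V →L[ℝ] V) (v : V) (f : ℝ → V),
        HasFDerivAt f (D.comp ((1 : ℝ →L[ℝ] ℝ).smulRight v)) 0 → HasDerivAt f (D v) 0 := by
      intro D v f hf
      simpa using hf.hasDerivAt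
    have h4 : fieldDeriv 𝓘(ℝ, V) dev ξ (φ 0 (ψ y)) = fieldDeriv 𝓘(ℝ, V) dev ξ (ψ y) := by
      rw [h0]
    rw [← h4]
    exact h3 (vderiv 𝓘(ℝ, V) dev (φ 0 (ψ y))) (ξ (φ 0 (ψ y))) _ h2.hasFDerivAt
  have hmem : (fun y : B => fieldDeriv 𝓘(ℝ, V) dev ξ (ψ y)) ∈ affineFunctionsOn B := by
    -- Pointwise convergence suffices here, so no uniformity of the flow in `y` is used.
    have hlim : Tendsto (fun t : ℝ => fun y : B => t⁻¹ • (dev (φ t (ψ y)) - y.1)) (𝓝[≠] 0)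
        (𝓝 (fun y : B => fieldDeriv 𝓘(ℝ, V) dev ξ (ψ y))) := by
      rw [tendsto_pi_nhds]
      intro y
      obtain ⟨-, hyU, hyy⟩ := hB y y.2
      have h1 := (hderiv y y.2).tendsto_slope_zero
      simp only [zero_add, (hφ (ψ y) hyU).1, hyy] at h1
      exact h1
    refine (isClosed_affineFunctionsOn B).mem_of_tendsto hlim ?_
    have h1 : ∀ᶠ t : ℝ in 𝓝[≠] 0, t ∈ Ioo (-ε) ε :=
      nhdsWithin_le_nhds (Ioo_mem_nhds (by linarith) hε)
    filter_upwards [h1] with t ht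
    obtain ⟨A, hA⟩ := hflow t ht
    refine mem_affineFunctionsOn.2 ⟨t⁻¹ • (A - ContinuousAffineMap.id ℝ V), fun y => ?_⟩
    rw [hA y y.2]
    rfl
  obtain ⟨η, hη⟩ := mem_affineFunctionsOn.1 hmem
  refine ⟨η, ?_⟩
  have h1 : ∀ᶠ q in 𝓝 p, dev q ∈ B :=
    hloc.contMDiffAt.continuousAt.eventually (Metric.ball_mem_nhds _ hr)
  filter_upwards [h1, hloc.localInverse_eventuallyEq_left] with q hq hq'
  have h2 := hη ⟨dev q, hq⟩
  have h3 : ψ (dev q) = q := hq'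
  simp only [h3] at h2
  exact h2

/-- Nearby local solutions share a germ, hence coincide; a locally constant choice on a connected
space is constant. -/
theorem IsAffineField.exists_developedField [PreconnectedSpace M] {dev : M → V}
    (hdev : IsDevelopmentMap dev) {ξ : (p : M) → TangentSpace 𝓘(ℝ, V) p}
    (hξ : IsAffineField ξ) : ∃ η : V →ᴬ[ℝ] V, IsDevelopedField dev ξ η := by
  choose η hη using fun p => hξ.exists_locally hdev p
  have hloc : IsLocallyConstant η := by
    refine (IsLocallyConstant.iff_eventually_eq η).2 fun p => ?_
    filter_upwards [(hη p).eventually_nhds] with q hq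
    refine hdev.affine_unique (p := q) ?_
    filter_upwards [hq, hη q] with z h1 h2
    rw [← h1, ← h2]
  cases isEmpty_or_nonempty M with
  | inl h => exact ⟨0, fun p => h.elim p⟩
  | inr h =>
    obtain ⟨p⟩ := h
    refine ⟨η p, fun q => ?_⟩
    have h1 : η q = η p := hloc.apply_eq_of_preconnectedSpace q p
    rw [← h1]
    exact (hη q).self_of_nhds

omit [FiniteDimensional ℝ V] [HasGroupoid M (affineGroupoid V)] in
theorem IsDevelopedField.unique [Nonempty M] {dev : M → V} (hdev : IsDevelopmentMap dev)
    {ξ : (p : M) → TangentSpace 𝓘(ℝ, V) p} {η η' : V →ᴬ[ℝ] V} (h : IsDevelopedField dev ξ η)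
    (h' : IsDevelopedField dev ξ η') : η' = η := by
  obtain ⟨p⟩ := ‹Nonempty M›
  refine hdev.affine_unique (p := p) (Eventually.of_forall fun q => ?_)
  exact (h' q).symm.trans (h q)

end AffineFields

/-! ### Hessians and local potentials in developed coordinates -/

section Hessian

variable {V : Type*} [NormedAddCommGroup V] [NormedSpace ℝ V]

/-- The second derivative of a function, as a field of bilinear forms. -/
def hessianForm (f : V → ℝ) (y : V) : V →L[ℝ] V →L[ℝ] ℝ := fderiv ℝ (fderiv ℝ f) y

theorem ContDiffAt.hessianForm {f : V → ℝ} {y : V} (hf : ContDiffAt ℝ ∞ f y) :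
    ContDiffAt ℝ ∞ (hessianForm f) y :=
  (hf.fderiv_right (m := ∞) (by simp)).fderiv_right (m := ∞) (by simp)

theorem hessianForm_symm {f : V → ℝ} {y : V} (hf : ContDiffAt ℝ ∞ f y) (a b : V) :
    hessianForm f y a b = hessianForm f y b a :=
  hf.isSymmSndFDerivAt (by simp [two_le_infty]) a b

/-- Symmetry of the second derivative of `fderiv ℝ f`. -/
theorem fderiv_hessianForm_swap_left {f : V → ℝ} {y : V} (hf : ContDiffAt ℝ ∞ f y) (a b c : V) :
    fderiv ℝ (hessianForm f) y a b c = fderiv ℝ (hessianForm f) y b a c := by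
  have h : IsSymmSndFDerivAt ℝ (fderiv ℝ f) y :=
    (hf.fderiv_right (m := ∞) (by simp)).isSymmSndFDerivAt (by simp [two_le_infty])
  exact congrArg (fun L : V →L[ℝ] ℝ => L c) (h a b)

/-- Differentiate the symmetry of the Hessian at nearby points. Together with the left swap this
gives total symmetry. -/
theorem fderiv_hessianForm_swap_right {f : V → ℝ} {y : V} (hf : ∀ᶠ z in 𝓝 y, ContDiffAt ℝ ∞ f z)
    (a b c : V) :
    fderiv ℝ (hessianForm f) y a b c = fderiv ℝ (hessianForm f) y a c b := by
  have hd : DifferentiableAt ℝ (hessianForm f) y :=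
    hf.self_of_nhds.hessianForm.differentiableAt (by simp)
  have key : ∀ b c : V, fderiv ℝ (fun z => hessianForm f z b c) y a =
      fderiv ℝ (hessianForm f) y a b c := by
    intro b c
    have h1 := (hd.hasFDerivAt.clm_apply (hasFDerivAt_const b y)).clm_apply (hasFDerivAt_const c y)
    rw [h1.fderiv]
    simp
  rw [← key b c, ← key c b]
  congr 1
  refine Filter.EventuallyEq.fderiv_eq ?_
  filter_upwards [hf] with z hz
  exact hessianForm_symm hz b c

/-- An affine map has constant derivative, so no first-order term of `f` appears. This is why
Hessian metrics make sense on affine manifolds. -/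
theorem hessianForm_comp_affine {f : V → ℝ} (A : V →ᴬ[ℝ] V) {y : V}
    (hf : ∀ᶠ z in 𝓝 (A y), ContDiffAt ℝ ∞ f z) (a b : V) :
    hessianForm (f ∘ A) y a b = hessianForm f (A y) (A.contLinear a) (A.contLinear b) := by
  have h1 : fderiv ℝ (f ∘ A) =ᶠ[𝓝 y] fun z => (fderiv ℝ f (A z)).comp A.contLinear := by
    filter_upwards [A.continuous.continuousAt.eventually hf] with z hz
    exact ((hz.differentiableAt (by simp)).hasFDerivAt.comp z A.hasFDerivAt).fderiv
  have h2 : HasFDerivAt (fderiv ℝ f) (hessianForm f (A y)) (A y) :=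
    ((hf.self_of_nhds.fderiv_right (m := ∞) (by simp)).differentiableAt (by simp)).hasFDerivAt
  have h3 := (h2.comp y A.hasFDerivAt).clm_comp (hasFDerivAt_const A.contLinear y)
  have h4 : hessianForm (f ∘ A) y = _ := h1.fderiv_eq.trans h3.fderiv
  rw [h4]
  simp

variable [FiniteDimensional ℝ V]
  {M : Type*} [TopologicalSpace M] [ChartedSpace V M] [HasGroupoid M (affineGroupoid V)]

/-- The given affine chart and `dev` differ by an affine equivalence, along which the potential is
transported. -/
theorem IsHessianMetric.exists_potential {g : SmoothMetric 𝓘(ℝ, V) M} (hg : IsHessianMetric g)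
    {dev : M → V} (hdev : IsDevelopmentMap dev) (p : M) :
    ∃ f : V → ℝ, (∀ᶠ y in 𝓝 (dev p), ContDiffAt ℝ ∞ f y) ∧
      ∀ᶠ q in 𝓝 p, ∀ v w : TangentSpace 𝓘(ℝ, V) q, g.inner q v w =
        hessianForm f (dev q) (vderiv 𝓘(ℝ, V) dev q v) (vderiv 𝓘(ℝ, V) dev q w) := by
  obtain ⟨x, hx, hpx, φ, hφ, hgφ⟩ := hg p
  obtain ⟨T, hT⟩ := hdev.exists_affineEquiv_comp hx hpx
  set A : V →ᴬ[ℝ] V := T.symm.toContinuousAffineMap with hA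
  have hAT : ∀ y, A (T y) = y := fun y => T.symm_apply_apply y
  have hxA : ∀ᶠ q in 𝓝 p, x q = A (dev q) := by
    filter_upwards [hT] with q hq
    rw [hq, hAT]
  have hφ' : ∀ y ∈ x.target, ∀ᶠ z in 𝓝 y, ContDiffAt ℝ ∞ φ z := by
    intro y hy
    filter_upwards [x.open_target.mem_nhds hy] with z hz
    exact hφ.contDiffAt (x.open_target.mem_nhds hz)
  refine ⟨φ ∘ A, ?_, ?_⟩
  · have h1 : A (dev p) ∈ x.target := by
      rw [← hxA.self_of_nhds]
      exact x.map_source hpx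
    filter_upwards [A.continuous.continuousAt.eventually (hφ' _ h1)] with y hy
    exact hy.comp y A.contDiff.contDiffAt
  · filter_upwards [x.open_source.mem_nhds hpx, hxA.eventually_nhds] with q hq hxq v w
    have h1 : A (dev q) = x q := hxq.self_of_nhds.symm
    have h2 : x.target ∈ 𝓝 (A (dev q)) := by
      rw [h1]
      exact x.open_target.mem_nhds (x.map_source hq)
    rw [hessianForm_comp_affine A (hφ' _ (mem_of_mem_nhds h2)), h1, hgφ q hq]
    have h3 : vderiv 𝓘(ℝ, V) x q = A.contLinear.comp (vderiv 𝓘(ℝ, V) dev q) := by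
      have h4 : x =ᶠ[𝓝 q] A ∘ dev := hxq
      rw [h4.vderiv_eq, vderiv_comp A.differentiable.differentiableAt
        ((hdev.1 q).mdifferentiableAt (by simp)), A.fderiv]
    have h6 : ∀ v : V, A.contLinear (vderiv 𝓘(ℝ, V) dev q v) = vderiv 𝓘(ℝ, V) x q v := by
      intro v
      rw [h3]
      rfl
    exact (congrArg₂ (fun a b => hessianForm φ (x q) a b) (h6 v) (h6 w)).symm

end Hessian

/-! ### Product coordinates, and boundedness of unit balls -/

section ProductDevelopment

variable {V : Type*} [NormedAddCommGroup V] [NormedSpace ℝ V]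
  {M : Type*} [TopologicalSpace M] [ChartedSpace V M]

/-- The flat coordinates on `M × V` given by a development map of `M`. -/
def prodDev (dev : M → V) (p : M × V) : V × V := (dev p.1, p.2)

theorem IsLocalDiffeomorphAt.prodDev {dev : M → V} {p : M × V}
    (h : IsLocalDiffeomorphAt 𝓘(ℝ, V) 𝓘(ℝ, V) ∞ dev p.1) :
    IsLocalDiffeomorphAt (𝓘(ℝ, V).prod 𝓘(ℝ, V)) 𝓘(ℝ, V × V) ∞ (prodDev dev) p := by
  obtain ⟨e, hp, he⟩ := h
  refine ⟨{ toPartialEquiv := e.toPartialEquiv.prod (PartialEquiv.refl V)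
            open_source := e.open_source.prod isOpen_univ
            open_target := e.open_target.prod isOpen_univ
            contMDiffOn_toFun := ?_
            contMDiffOn_invFun := ?_ }, ⟨hp, mem_univ _⟩, ?_⟩
  · exact (e.contMDiffOn_toFun.comp contMDiff_fst.contMDiffOn fun q hq => hq.1).prodMk_space
      contMDiff_snd.contMDiffOn
  · refine ContMDiffOn.prodMk ?_ ?_
    · exact e.contMDiffOn_invFun.comp
        (contDiff_fst.contMDiff (𝕜 := ℝ) (E := V × V) (E' := V)).contMDiffOn fun q hq => hq.1
    · exact (contDiff_snd.contMDiff (𝕜 := ℝ) (E := V × V) (E' := V)).contMDiffOn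
  · intro q hq
    exact Prod.ext (he hq.1) rfl

theorem vderiv_prodDev {dev : M → V} {p : M × V}
    (h : MDifferentiableAt 𝓘(ℝ, V) 𝓘(ℝ, V) dev p.1) :
    vderiv (𝓘(ℝ, V).prod 𝓘(ℝ, V)) (prodDev dev) p =
      (vderiv 𝓘(ℝ, V) dev p.1).prodMap (ContinuousLinearMap.id ℝ V) := by
  have h1 : HasMFDerivAt (𝓘(ℝ, V).prod 𝓘(ℝ, V)) 𝓘(ℝ, V) (fun q : M × V => dev q.1) p _ :=
    h.hasMFDerivAt.comp p (hasMFDerivAt_fst p)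
  have h2 := (hasMFDerivAt_iff_hasFDerivAt_chart.1 h1)
  have h3 := (hasMFDerivAt_iff_hasFDerivAt_chart.1
    (hasMFDerivAt_snd (I := 𝓘(ℝ, V)) (I' := 𝓘(ℝ, V)) p))
  have h4 : HasMFDerivAt (𝓘(ℝ, V).prod 𝓘(ℝ, V)) 𝓘(ℝ, V × V) (prodDev dev) p _ :=
    hasMFDerivAt_iff_hasFDerivAt_chart.2 ⟨h2.1.prodMk h3.1, h2.2.prodMk h3.2⟩
  rw [h4.vderiv_eq]
  rfl

/-- By compactness `b` has a positive lower bound `m` on the unit sphere, and homogeneity gives `m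
‖v‖² ≤ b v v`. -/
theorem isVonNBounded_of_posDef {W : Type*} [NormedAddCommGroup W] [NormedSpace ℝ W]
    [FiniteDimensional ℝ W] (b : W →L[ℝ] W →L[ℝ] ℝ) (hb : ∀ v, v ≠ 0 → 0 < b v v) :
    Bornology.IsVonNBounded ℝ {v | b v v < 1} := by
  have := FiniteDimensional.proper_real W
  rw [NormedSpace.isVonNBounded_iff]
  obtain ⟨m, hm, hmb⟩ : ∃ m, 0 < m ∧ ∀ v ∈ Metric.sphere (0 : W) 1, m ≤ b v v := by
    have hcont : Continuous fun v => b v v := by fun_prop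
    -- The sphere is empty when `W = 0`, and then any positive `m` works.
    rcases (Metric.sphere (0 : W) 1).eq_empty_or_nonempty with h | h
    · exact ⟨1, one_pos, by simp [h]⟩
    · obtain ⟨v, hv, hmin⟩ := (isCompact_sphere (0 : W) 1).exists_isMinOn h hcont.continuousOn
      refine ⟨b v v, hb v ?_, fun w hw => hmin hw⟩
      rintro rfl
      simp at hv
  -- This radius avoids a square root: being at least `1` it is at most its square, and `m (m⁻¹ + 1)
  -- = 1 + m > 1`.
  refine (Metric.isBounded_iff_subset_closedBall 0).2 ⟨m⁻¹ + 1, fun v hv => ?_⟩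
  have hv' : b v v < 1 := hv
  rw [mem_closedBall_zero_iff]
  by_contra! hlt
  have hpos : 0 < ‖v‖ := lt_trans (by positivity) hlt
  have h1 := hmb (‖v‖⁻¹ • v) (by simp [norm_smul, hpos.ne'])
  simp only [map_smul, smul_apply, smul_eq_mul] at h1
  have h2 : m * ‖v‖ ^ 2 ≤ b v v := by
    have h3 := mul_le_mul_of_nonneg_right h1 (sq_nonneg ‖v‖)
    have h4 : ‖v‖⁻¹ * (‖v‖⁻¹ * b v v) * ‖v‖ ^ 2 = b v v := by field_simp
    rwa [h4] at h3
  have h5 : m⁻¹ + 1 ≤ (m⁻¹ + 1) ^ 2 := by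
    have : 0 < m⁻¹ := by positivity
    nlinarith
  have h6 : (m⁻¹ + 1) ^ 2 < ‖v‖ ^ 2 := by
    have : 0 < m⁻¹ + 1 := by positivity
    gcongr
  have h7 : m * (m⁻¹ + 1) = 1 + m := by field_simp
  nlinarith

end ProductDevelopment

/-! ### Constant-coefficient algebra on `V ⊕ iV` -/

section TubeForms

variable {V : Type*} [NormedAddCommGroup V] [NormedSpace ℝ V]

set_option maxSynthPendingDepth 3

/-- The pullback of bilinear forms along a pair of linear maps. -/
def pullForm {W : Type*} [NormedAddCommGroup W] [NormedSpace ℝ W] (P Q : W →L[ℝ] V) :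
    (V →L[ℝ] V →L[ℝ] ℝ) →L[ℝ] (W →L[ℝ] W →L[ℝ] ℝ) :=
  (ContinuousLinearMap.precomp (W →L[ℝ] ℝ) P).comp
    (ContinuousLinearMap.postcomp V (ContinuousLinearMap.precomp ℝ Q))

/-- The form `(v, w) ↦ h v.1 w.1 + h v.2 w.2` on `V × V`. -/
def tubeForm : (V →L[ℝ] V →L[ℝ] ℝ) →L[ℝ] (V × V →L[ℝ] V × V →L[ℝ] ℝ) :=
  pullForm (.fst ℝ V V) (.fst ℝ V V) + pullForm (.snd ℝ V V) (.snd ℝ V V)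

theorem tubeForm_apply (h : V →L[ℝ] V →L[ℝ] ℝ) (v w : V × V) :
    tubeForm h v w = h v.1 w.1 + h v.2 w.2 := rfl

/-- The form `(v, w) ↦ h v.1 w.2 - h v.2 w.1` on `V × V`. -/
def tubeTwoForm : (V →L[ℝ] V →L[ℝ] ℝ) →L[ℝ] (V × V →L[ℝ] V × V →L[ℝ] ℝ) :=
  pullForm (.fst ℝ V V) (.snd ℝ V V) - pullForm (.snd ℝ V V) (.fst ℝ V V)

theorem tubeTwoForm_apply (h : V →L[ℝ] V →L[ℝ] ℝ) (v w : V × V) :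
    tubeTwoForm h v w = h v.1 w.2 - h v.2 w.1 := rfl

/-- Multiplication by `i` on `V × V = V ⊕ iV`. -/
def mulIMap : V × V →L[ℝ] V × V :=
  (-ContinuousLinearMap.snd ℝ V V).prod (ContinuousLinearMap.fst ℝ V V)

theorem mulIMap_apply (v : V × V) : mulIMap v = (-v.2, v.1) := rfl

theorem hasFDerivAt_clm_comp_fst {E : Type*} [NormedAddCommGroup E] [NormedSpace ℝ E]
    {E' : Type*} [NormedAddCommGroup E'] [NormedSpace ℝ E'] (L : E →L[ℝ] E') {h : V → E}
    {z : V × V} (hh : DifferentiableAt ℝ h z.1) :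
    HasFDerivAt (fun z : V × V => L (h z.1))
      (L.comp ((fderiv ℝ h z.1).comp (ContinuousLinearMap.fst ℝ V V))) z :=
  L.hasFDerivAt.comp z (hh.hasFDerivAt.comp z hasFDerivAt_fst)

end TubeForms

/-! ### The r-map metric -/

section RMap

variable {V : Type*} [NormedAddCommGroup V] [NormedSpace ℝ V] [FiniteDimensional ℝ V]
  {M : Type*} [TopologicalSpace M] [ChartedSpace V M] [HasGroupoid M (affineGroupoid V)]

set_option maxSynthPendingDepth 3

omit [FiniteDimensional ℝ V] [HasGroupoid M (affineGroupoid V)] in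
theorem vderiv_prodDev_apply {dev : M → V} (hdev : IsDevelopmentMap dev) (p : M × V) (v : V × V) :
    vderiv (𝓘(ℝ, V).prod 𝓘(ℝ, V)) (prodDev dev) p v = (vderiv 𝓘(ℝ, V) dev p.1 v.1, v.2) := by
  rw [vderiv_prodDev ((hdev.1 p.1).mdifferentiableAt (by simp))]
  rfl

omit [FiniteDimensional ℝ V] [HasGroupoid M (affineGroupoid V)] in
theorem IsDevelopmentMap.vderiv_inverse {dev : M → V} (hdev : IsDevelopmentMap dev) (p : M)
    (w : V) : vderiv 𝓘(ℝ, V) dev p ((vderiv 𝓘(ℝ, V) dev p).inverse w) = w := by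
  rw [← (hdev.1 p).coe_vderivEquiv, ContinuousLinearMap.inverse_equiv]
  exact (hdev.1 p).vderivEquiv.apply_symm_apply w

omit [FiniteDimensional ℝ V] [HasGroupoid M (affineGroupoid V)] in
theorem IsDevelopmentMap.inverse_vderiv {dev : M → V} (hdev : IsDevelopmentMap dev) (p : M)
    (v : V) : (vderiv 𝓘(ℝ, V) dev p).inverse (vderiv 𝓘(ℝ, V) dev p v) = v := by
  rw [← (hdev.1 p).coe_vderivEquiv, ContinuousLinearMap.inverse_equiv]
  exact (hdev.1 p).vderivEquiv.symm_apply_apply v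

/-- A metric at a point, as a bilinear form on the model space. -/
def metricForm (g : SmoothMetric 𝓘(ℝ, V) M) (p : M) : V →L[ℝ] V →L[ℝ] ℝ := g.inner p

omit [FiniteDimensional ℝ V] [HasGroupoid M (affineGroupoid V)] in
theorem rComplexStructure_apply (dev : M → V) (p : M × V) (v : V × V) :
    rComplexStructure dev p v =
      (-(vderiv 𝓘(ℝ, V) dev p.1).inverse v.2, vderiv 𝓘(ℝ, V) dev p.1 v.1) := rfl

/-- The r-map metric at a point, as a bilinear form on the model space. -/
def rForm (g : SmoothMetric 𝓘(ℝ, V) M) (dev : M → V) (p : M × V) :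
    V × V →L[ℝ] V × V →L[ℝ] ℝ :=
  pullForm (.fst ℝ V V) (.fst ℝ V V) (metricForm g p.1) +
    pullForm ((vderiv 𝓘(ℝ, V) dev p.1).inverse.comp (.snd ℝ V V))
      ((vderiv 𝓘(ℝ, V) dev p.1).inverse.comp (.snd ℝ V V)) (metricForm g p.1)

omit [FiniteDimensional ℝ V] in
theorem rForm_apply (g : SmoothMetric 𝓘(ℝ, V) M) (dev : M → V) (p : M × V) (v w : V × V) :
    rForm g dev p v w = metricForm g p.1 v.1 w.1 +
      metricForm g p.1 ((vderiv 𝓘(ℝ, V) dev p.1).inverse v.2)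
        ((vderiv 𝓘(ℝ, V) dev p.1).inverse w.2) := rfl

-- The projection differentiates to the first component, and the two minus signs from `I` cancel.
omit [FiniteDimensional ℝ V] in
theorem rMetric_eq_rForm (g : SmoothMetric 𝓘(ℝ, V) M) (dev : M → V) (p : M × V) (v w : V × V) :
    rMetric g dev p v w = rForm g dev p v w := by
  have h1 : ∀ v w : V × V, pullbackMetric g p v w = metricForm g p.1 v.1 w.1 := by
    intro v w
    unfold pullbackMetric
    rw [mfderiv_fst]
    rfl
  refine (congrArg₂ (· + ·) (h1 v w) (h1 (rComplexStructure dev p v)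
    (rComplexStructure dev p w))).trans ?_
  rw [rForm_apply, rComplexStructure_apply, rComplexStructure_apply]
  simp

omit [FiniteDimensional ℝ V] in
theorem metricForm_symm (g : SmoothMetric 𝓘(ℝ, V) M) (p : M) (v w : V) :
    metricForm g p v w = metricForm g p w v := g.symm p v w

omit [FiniteDimensional ℝ V] in
theorem metricForm_pos (g : SmoothMetric 𝓘(ℝ, V) M) (p : M) {v : V} (hv : v ≠ 0) :
    0 < metricForm g p v v := g.pos p v hv

omit [FiniteDimensional ℝ V] in
theorem rForm_symm (g : SmoothMetric 𝓘(ℝ, V) M) (dev : M → V) (p : M × V) (v w : V × V) :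
    rForm g dev p v w = rForm g dev p w v := by
  rw [rForm_apply, rForm_apply, metricForm_symm, metricForm_symm g p.1 (_ : V)
    ((vderiv 𝓘(ℝ, V) dev p.1).inverse w.2)]

omit [FiniteDimensional ℝ V] in
theorem rForm_pos (g : SmoothMetric 𝓘(ℝ, V) M) {dev : M → V} (hdev : IsDevelopmentMap dev)
    (p : M × V) {v : V × V} (hv : v ≠ 0) : 0 < rForm g dev p v v := by
  rw [rForm_apply]
  have hnn : ∀ u : V, 0 ≤ metricForm g p.1 u u := by
    intro u
    rcases eq_or_ne u 0 with rfl | hu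
    · simp
    · exact (metricForm_pos g p.1 hu).le
  by_cases h1 : v.1 = 0
  · have h2 : (vderiv 𝓘(ℝ, V) dev p.1).inverse v.2 ≠ 0 := by
      intro h
      have h3 := hdev.vderiv_inverse p.1 v.2
      rw [h, map_zero] at h3
      exact hv (Prod.ext h1 h3.symm)
    exact add_pos_of_nonneg_of_pos (hnn _) (metricForm_pos g p.1 h2)
  · exact add_pos_of_pos_of_nonneg (metricForm_pos g p.1 h1) (hnn _)

/-- Near `p`, in the flat coordinates given by the development map, the metric is the Hessian of the
smooth function `f`. -/
structure IsPotentialNear (g : SmoothMetric 𝓘(ℝ, V) M) (dev : M → V) (f : V → ℝ) (p : M) :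
    Prop where
  contDiffAt : ∀ᶠ y in 𝓝 (dev p), ContDiffAt ℝ ∞ f y
  metric : ∀ᶠ q in 𝓝 p, ∀ v w : TangentSpace 𝓘(ℝ, V) q, g.inner q v w =
    hessianForm f (dev q) (vderiv 𝓘(ℝ, V) dev q v) (vderiv 𝓘(ℝ, V) dev q w)

-- Applying the differential of `dev` undoes its inverse in the second block, so both blocks carry
-- the same Hessian, a function of `x` alone.
omit [FiniteDimensional ℝ V] in
theorem IsPotentialNear.rForm_eq {g : SmoothMetric 𝓘(ℝ, V) M} {dev : M → V}
    (hdev : IsDevelopmentMap dev) {f : V → ℝ} {p : M × V} (hf : IsPotentialNear g dev f p.1) :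
    ∀ᶠ q in 𝓝 p, ∀ v w : V × V, rForm g dev q v w = tubeForm (hessianForm f (prodDev dev q).1)
      (vderiv (𝓘(ℝ, V).prod 𝓘(ℝ, V)) (prodDev dev) q v)
      (vderiv (𝓘(ℝ, V).prod 𝓘(ℝ, V)) (prodDev dev) q w) := by
  filter_upwards [continuousAt_fst.eventually hf.metric] with q hq v w
  have hq' : ∀ v w : V, metricForm g q.1 v w = hessianForm f (dev q.1)
    (vderiv 𝓘(ℝ, V) dev q.1 v) (vderiv 𝓘(ℝ, V) dev q.1 w) := hq
  rw [vderiv_prodDev_apply hdev, vderiv_prodDev_apply hdev, tubeForm_apply, rForm_apply, hq', hq',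
    hdev.vderiv_inverse, hdev.vderiv_inverse]
  rfl

omit [FiniteDimensional ℝ V] in
theorem contDiffAt_clm_comp_fst {E : Type*} [NormedAddCommGroup E] [NormedSpace ℝ E]
    {E' : Type*} [NormedAddCommGroup E'] [NormedSpace ℝ E'] (L : E →L[ℝ] E') {h : V → E}
    {z : V × V} (hh : ContDiffAt ℝ ∞ h z.1) : ContDiffAt ℝ ∞ (fun z : V × V => L (h z.1)) z :=
  L.contDiff.contDiffAt.comp z (hh.comp z contDiffAt_fst)

/-- The r-map metric. -/
def rSmoothMetric (g : SmoothMetric 𝓘(ℝ, V) M) (hg : IsHessianMetric g) {dev : M → V}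
    (hdev : IsDevelopmentMap dev) : SmoothMetric (𝓘(ℝ, V).prod 𝓘(ℝ, V)) (M × V) where
  inner p := rForm g dev p
  symm p v w := rForm_symm g dev p v w
  pos p v hv := rForm_pos g hdev p hv
  isVonNBounded p := isVonNBounded_of_posDef (rForm g dev p) fun _ hv => rForm_pos g hdev p hv
  contMDiff p := by
    obtain ⟨f, hf, hfg⟩ := hg.exists_potential hdev p.1
    have h1 : ContMDiffAt (𝓘(ℝ, V).prod 𝓘(ℝ, V)) 𝓘(ℝ, V × V) ∞ (prodDev dev) p :=
      (hdev.1 p.1).prodDev.contMDiffAt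
    have h2 : ContDiffAt ℝ ∞ (fun z : V × V => tubeForm (hessianForm f z.1)) (prodDev dev p) :=
      contDiffAt_clm_comp_fst (h := hessianForm f) (z := prodDev dev p) tubeForm
        hf.self_of_nhds.hessianForm
    have h3 := IsPotentialNear.rForm_eq (p := p) hdev ⟨hf, hfg⟩
    have h4 := contMDiffAt_bilin_section (b := fun q => rForm g dev q) h1 h2 h3
    exact h4

end RMap

/-! ### Closedness, holomorphy and homothety -/

section Kahler

variable {V : Type*} [NormedAddCommGroup V] [NormedSpace ℝ V] [FiniteDimensional ℝ V]
  {M : Type*} [TopologicalSpace M] [ChartedSpace V M] [HasGroupoid M (affineGroupoid V)]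
  {g : SmoothMetric 𝓘(ℝ, V) M} {dev : M → V}

set_option maxSynthPendingDepth 3

theorem IsHessianMetric.exists_isPotentialNear (hg : IsHessianMetric g)
    (hdev : IsDevelopmentMap dev) (p : M) : ∃ f, IsPotentialNear g dev f p := by
  obtain ⟨f, hf, hfg⟩ := hg.exists_potential hdev p
  exact ⟨f, hf, hfg⟩

-- Constancy of `I` in these coordinates underlies both integrability and the vanishing of `L_ξ I`.
omit [FiniteDimensional ℝ V] [HasGroupoid M (affineGroupoid V)] in
theorem vderiv_prodDev_rComplexStructure (hdev : IsDevelopmentMap dev) (p : M × V) (v : V × V) :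
    vderiv (𝓘(ℝ, V).prod 𝓘(ℝ, V)) (prodDev dev) p (rComplexStructure dev p v) =
      mulIMap (vderiv (𝓘(ℝ, V).prod 𝓘(ℝ, V)) (prodDev dev) p v) := by
  refine (vderiv_prodDev_apply hdev p _).trans ?_
  rw [vderiv_prodDev_apply hdev p v, rComplexStructure_apply, mulIMap_apply]
  simp only [map_neg, hdev.vderiv_inverse]

omit [FiniteDimensional ℝ V] [HasGroupoid M (affineGroupoid V)] in
theorem rComplexStructure_rComplexStructure (hdev : IsDevelopmentMap dev) (p : M × V) (v : V × V) :
    rComplexStructure dev p (rComplexStructure dev p v) = (-v : V × V) := by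
  refine (rComplexStructure_apply dev p _).trans ?_
  rw [rComplexStructure_apply]
  simp only [map_neg, hdev.vderiv_inverse, hdev.inverse_vderiv]
  rfl

omit [FiniteDimensional ℝ V] in
theorem rForm_rComplexStructure (hdev : IsDevelopmentMap dev) (p : M × V) (v w : V × V) :
    rForm g dev p (rComplexStructure dev p v) (rComplexStructure dev p w) = rForm g dev p v w := by
  rw [rComplexStructure_apply, rComplexStructure_apply, rForm_apply, rForm_apply]
  simp only [map_neg, hdev.inverse_vderiv, neg_apply, neg_neg]
  rw [add_comm]

omit [FiniteDimensional ℝ V] in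
theorem tubeForm_mulIMap (h : V →L[ℝ] V →L[ℝ] ℝ) (v w : V × V) :
    tubeForm h (mulIMap v) w = tubeTwoForm h v w := by
  rw [tubeForm_apply, tubeTwoForm_apply, mulIMap_apply, map_neg, neg_apply]
  ring

omit [FiniteDimensional ℝ V] in
/-- The fundamental form of the r-map metric. -/
theorem IsPotentialNear.fundamentalForm_eq (hdev : IsDevelopmentMap dev) {f : V → ℝ} {p : M × V}
    (hf : IsPotentialNear g dev f p.1) :
    ∀ᶠ q in 𝓝 p, ∀ v w : V × V, rForm g dev q (rComplexStructure dev q v) w =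
      tubeTwoForm (hessianForm f (prodDev dev q).1)
        (vderiv (𝓘(ℝ, V).prod 𝓘(ℝ, V)) (prodDev dev) q v)
        (vderiv (𝓘(ℝ, V).prod 𝓘(ℝ, V)) (prodDev dev) q w) := by
  filter_upwards [hf.rForm_eq hdev] with q hq v w
  rw [← tubeForm_mulIMap, ← vderiv_prodDev_rComplexStructure hdev]
  exact hq _ _

omit [FiniteDimensional ℝ V] in
theorem fderiv_clm_comp_fst {E : Type*} [NormedAddCommGroup E] [NormedSpace ℝ E]
    {E' : Type*} [NormedAddCommGroup E'] [NormedSpace ℝ E'] (L : E →L[ℝ] E') {h : V → E}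
    {z : V × V} (hh : DifferentiableAt ℝ h z.1) (a : V × V) :
    fderiv ℝ (fun z : V × V => L (h z.1)) z a = L (fderiv ℝ h z.1 a.1) := by
  rw [(hasFDerivAt_clm_comp_fst L hh).fderiv]
  rfl

theorem IsPotentialNear.closed (hdev : IsDevelopmentMap dev) {f : V → ℝ} {p : M × V}
    (hf : IsPotentialNear g dev f p.1)
    {X Y Z : (q : M × V) → TangentSpace (𝓘(ℝ, V).prod 𝓘(ℝ, V)) q}
    (hX : SmoothFieldAt (𝓘(ℝ, V).prod 𝓘(ℝ, V)) X p)
    (hY : SmoothFieldAt (𝓘(ℝ, V).prod 𝓘(ℝ, V)) Y p)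
    (hZ : SmoothFieldAt (𝓘(ℝ, V).prod 𝓘(ℝ, V)) Z p) :
    extDerivTwoForm (fun q v w => rForm g dev q (rComplexStructure dev q v) w) X Y Z p = 0 := by
  have hf0 : ContDiffAt ℝ ∞ f (prodDev dev p).1 := hf.contDiffAt.self_of_nhds
  have hd : DifferentiableAt ℝ (hessianForm f) (prodDev dev p).1 :=
    hf0.hessianForm.differentiableAt (by simp)
  have hB : DifferentiableAt ℝ (fun z : V × V => tubeTwoForm (hessianForm f z.1)) (prodDev dev p) :=
    (hasFDerivAt_clm_comp_fst (h := hessianForm f) tubeTwoForm hd).differentiableAt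
  have key := extDerivTwoForm_eq (hdev.1 p.1).prodDev.contMDiffAt hB (fun a b => by
    rw [tubeTwoForm_apply, tubeTwoForm_apply, hessianForm_symm hf0 a.1, hessianForm_symm hf0 a.2]
    ring) (hf.fundamentalForm_eq hdev) hX hY hZ
  refine key.trans ?_
  have hD : ∀ a b c : V × V,
      fderiv ℝ (fun z : V × V => tubeTwoForm (hessianForm f z.1)) (prodDev dev p) a b c =
        fderiv ℝ (hessianForm f) (prodDev dev p).1 a.1 b.1 c.2 -
        fderiv ℝ (hessianForm f) (prodDev dev p).1 a.1 b.2 c.1 := by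
    intro a b c
    rw [fderiv_clm_comp_fst (h := hessianForm f) tubeTwoForm hd a]
    rfl
  have hs1 : ∀ a b c : V, fderiv ℝ (hessianForm f) (prodDev dev p).1 a b c =
      fderiv ℝ (hessianForm f) (prodDev dev p).1 b a c := fderiv_hessianForm_swap_left hf0
  have hs2 : ∀ a b c : V, fderiv ℝ (hessianForm f) (prodDev dev p).1 a b c =
      fderiv ℝ (hessianForm f) (prodDev dev p).1 a c b :=
    fderiv_hessianForm_swap_right hf.contDiffAt
  rw [hD, hD, hD]
  generalize fieldDeriv _ (prodDev dev) X p = x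
  generalize fieldDeriv _ (prodDev dev) Y p = y
  generalize fieldDeriv _ (prodDev dev) Z p = z
  generalize fderiv ℝ (hessianForm f) (prodDev dev p).1 = T at hs1 hs2
  -- The six terms pair off by which of `x`, `y`, `z` supplies its imaginary part; symmetry of `T`
  -- makes each pair cancel.
  rw [hs1 z.1 x.1 y.2, hs2 x.1 y.2 z.1, hs2 y.1 z.2 x.1, hs1 y.1 x.1 z.2, hs2 z.1 x.2 y.1,
    hs1 z.1 y.1 x.2]
  ring

/-- The field `(x, y) ↦ (η x, η y)` on `V × V`. -/
def prodField (η : V →ᴬ[ℝ] V) (z : V × V) : V × V := (η z.1, η z.2)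

omit [FiniteDimensional ℝ V] in
theorem hasFDerivAt_prodField (η : V →ᴬ[ℝ] V) (z : V × V) :
    HasFDerivAt (prodField η) (η.contLinear.prodMap η.contLinear) z :=
  (η.hasFDerivAt.comp z hasFDerivAt_fst).prodMk (η.hasFDerivAt.comp z hasFDerivAt_snd)

omit [FiniteDimensional ℝ V] [HasGroupoid M (affineGroupoid V)] in
theorem fieldDeriv_sumField (hdev : IsDevelopmentMap dev) {ξ : (p : M) → TangentSpace 𝓘(ℝ, V) p}
    {η : V →ᴬ[ℝ] V} (hη : IsDevelopedField dev ξ η) :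
    fieldDeriv (𝓘(ℝ, V).prod 𝓘(ℝ, V)) (prodDev dev) (sumField ξ η) =
      prodField η ∘ prodDev dev := by
  ext1 q
  have h1 : vderiv 𝓘(ℝ, V) dev q.1 (ξ q.1) = η (dev q.1) := hη q.1
  have h2 : (sumField ξ η q : V × V) = (ξ q.1, η q.2) :=
    Prod.ext (add_zero (ξ q.1 : V)) (zero_add (η q.2))
  refine (vderiv_prodDev_apply hdev q (sumField ξ η q)).trans ?_
  rw [h2]
  exact Prod.ext h1 rfl

theorem smoothFieldAt_sumField (hdev : IsDevelopmentMap dev)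
    {ξ : (p : M) → TangentSpace 𝓘(ℝ, V) p} {η : V →ᴬ[ℝ] V} (hη : IsDevelopedField dev ξ η)
    (p : M × V) : SmoothFieldAt (𝓘(ℝ, V).prod 𝓘(ℝ, V)) (sumField ξ η) p := by
  have := FiniteDimensional.complete ℝ V
  refine smoothFieldAt_of_fieldDeriv (hdev.1 p.1).prodDev ?_
  rw [fieldDeriv_sumField hdev hη]
  have h1 : ContDiff ℝ ∞ (prodField η) :=
    (η.contDiff.comp contDiff_fst).prodMk (η.contDiff.comp contDiff_snd)
  exact h1.contMDiff.contMDiffAt.comp p (hdev.1 p.1).prodDev.contMDiffAt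

/-- The derivative of `(η x, η y)` is the same linear map on both factors, hence complex linear. -/
theorem isHolomorphicField_sumField (hdev : IsDevelopmentMap dev)
    {ξ : (p : M) → TangentSpace 𝓘(ℝ, V) p} {η : V →ᴬ[ℝ] V} (hη : IsDevelopedField dev ξ η) :
    IsHolomorphicField (rComplexStructure dev) (sumField ξ η) := by
  have := FiniteDimensional.complete ℝ V
  refine ⟨smoothFieldAt_sumField hdev hη, fun p X hX => ?_⟩
  refine mlieBracket_complexStructure (hdev.1 p.1).prodDev
    (Eventually.of_forall fun q v => vderiv_prodDev_rComplexStructure hdev q v)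
    (smoothFieldAt_sumField hdev hη p) (hasFDerivAt_prodField η _).differentiableAt
    (fieldDeriv_sumField hdev hη).eventuallyEq (fun a => ?_) hX
  rw [(hasFDerivAt_prodField η _).fderiv]
  refine Prod.ext ?_ rfl
  exact map_neg η.contLinear a.2

/-- The coefficients do not depend on `y`, so only `η x` differentiates them. The equation at `(x,
y)` is the sum of the equation for `g` at `x` on the real parts and on the imaginary parts. -/
theorem lieDerivEqTwice_rSmoothMetric (hg : IsHessianMetric g) (hdev : IsDevelopmentMap dev)
    {ξ : (p : M) → TangentSpace 𝓘(ℝ, V) p} {η : V →ᴬ[ℝ] V} (hη : IsDevelopedField dev ξ η)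
    (hξ : ∀ p, SmoothFieldAt 𝓘(ℝ, V) ξ p) (hhom : LieDerivEqTwice g ξ) :
    LieDerivEqTwice (rSmoothMetric g hg hdev) (sumField ξ η) := by
  have := FiniteDimensional.complete ℝ V
  intro p
  obtain ⟨f, hf⟩ := hg.exists_isPotentialNear hdev p.1
  have hf0 : ContDiffAt ℝ ∞ f (prodDev dev p).1 := hf.contDiffAt.self_of_nhds
  have hd : DifferentiableAt ℝ (hessianForm f) (prodDev dev p).1 :=
    hf0.hessianForm.differentiableAt (by simp)
  have hB : DifferentiableAt ℝ (fun z : V × V => tubeForm (hessianForm f z.1)) (prodDev dev p) :=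
    (hasFDerivAt_clm_comp_fst (h := hessianForm f) tubeForm hd).differentiableAt
  have hM : ∀ a b : V, fderiv ℝ (hessianForm f) (dev p.1) (η (dev p.1)) a b
      + hessianForm f (dev p.1) (fderiv ℝ η (dev p.1) a) b
      + hessianForm f (dev p.1) a (fderiv ℝ η (dev p.1) b) = 2 * hessianForm f (dev p.1) a b :=
    (lieDerivMetric_eq_two_iff (hdev.1 p.1) hd hf.metric (hξ p.1)
      η.hasFDerivAt.differentiableAt (Eventually.of_forall hη)).1 (hhom p.1)
  have hmetric : ∀ᶠ q in 𝓝 p, ∀ v w, (rSmoothMetric g hg hdev).inner q v w =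
      tubeForm (hessianForm f (prodDev dev q).1)
        (vderiv (𝓘(ℝ, V).prod 𝓘(ℝ, V)) (prodDev dev) q v)
        (vderiv (𝓘(ℝ, V).prod 𝓘(ℝ, V)) (prodDev dev) q w) := hf.rForm_eq hdev
  have key := lieDerivMetric_eq_two_iff (B := fun z : V × V => tubeForm (hessianForm f z.1))
    (hdev.1 p.1).prodDev hB hmetric (smoothFieldAt_sumField hdev hη p)
    (hasFDerivAt_prodField η _).differentiableAt (fieldDeriv_sumField hdev hη).eventuallyEq
  refine key.2 fun a b => ?_
  rw [fderiv_clm_comp_fst (h := hessianForm f) tubeForm hd, (hasFDerivAt_prodField η _).fderiv]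
  rw [η.fderiv] at hM
  have h1 := hM a.1 b.1
  have h2 := hM a.2 b.2
  have hL : ∀ a : V × V, η.contLinear.prodMap η.contLinear a =
      (η.contLinear a.1, η.contLinear a.2) := fun _ => rfl
  simp only [tubeForm_apply, hL, prodField, prodDev]
  linarith

end Kahler

/-! ### Holomorphic coordinates and assembly -/

section ComplexCoordinates

/-- The identification `(x, y) ↦ x + i y` of `ℝⁿ × ℝⁿ` with `ℂⁿ`. -/
def euclideanProdEquivComplex (n : ℕ) :
    (EuclideanSpace ℝ (Fin n) × EuclideanSpace ℝ (Fin n)) ≃L[ℝ] EuclideanSpace ℂ (Fin n) :=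
  LinearEquiv.toContinuousLinearEquiv
    { toFun := fun w => WithLp.toLp 2 fun i => (⟨w.1 i, w.2 i⟩ : ℂ)
      invFun := fun z => (WithLp.toLp 2 fun i => (z i).re, WithLp.toLp 2 fun i => (z i).im)
      map_add' := fun v w => by ext i; apply Complex.ext <;> simp
      map_smul' := fun r w => by ext i; apply Complex.ext <;> simp
      left_inv := fun w => rfl
      right_inv := fun z => rfl }

theorem euclideanProdEquivComplex_mulIMap {n : ℕ}
    (w : EuclideanSpace ℝ (Fin n) × EuclideanSpace ℝ (Fin n)) :
    euclideanProdEquivComplex n (mulIMap w) = Complex.I • euclideanProdEquivComplex n w := by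
  have h : ∀ (w : EuclideanSpace ℝ (Fin n) × EuclideanSpace ℝ (Fin n)) (i : Fin n),
      euclideanProdEquivComplex n w i = (⟨w.1 i, w.2 i⟩ : ℂ) := fun _ _ => rfl
  ext i
  rw [PiLp.smul_apply, h, h, mulIMap_apply]
  apply Complex.ext <;> simp

variable {n : ℕ} {M : Type*} [TopologicalSpace M] [ChartedSpace (EuclideanSpace ℝ (Fin n)) M]
  [HasGroupoid M (affineGroupoid (EuclideanSpace ℝ (Fin n)))]

omit [HasGroupoid M (affineGroupoid (EuclideanSpace ℝ (Fin n)))] in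
theorem isComplexStructure_rComplexStructure {dev : M → EuclideanSpace ℝ (Fin n)}
    (hdev : IsDevelopmentMap dev) : IsComplexStructure (rComplexStructure dev) where
  sq p v := rComplexStructure_rComplexStructure hdev p v
  coords p := by
    refine ⟨n, euclideanProdEquivComplex n ∘ prodDev dev, ?_, Eventually.of_forall fun q v => ?_⟩
    · exact (hdev.1 p.1).prodDev.comp _ _
        ((euclideanProdEquivComplex n).toDiffeomorph.isLocalDiffeomorph (prodDev dev p))
    · have hd : vderiv (𝓘(ℝ, EuclideanSpace ℝ (Fin n)).prod 𝓘(ℝ, EuclideanSpace ℝ (Fin n)))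
          (euclideanProdEquivComplex n ∘ prodDev dev) q = _ :=
        vderiv_comp (euclideanProdEquivComplex n).differentiableAt
          ((hdev.1 q.1).prodDev.mdifferentiableAt (by simp))
      rw [(euclideanProdEquivComplex n).fderiv] at hd
      have hz : ∀ v, coordDeriv (𝓘(ℝ, EuclideanSpace ℝ (Fin n)).prod 𝓘(ℝ, EuclideanSpace ℝ (Fin n)))
          (euclideanProdEquivComplex n ∘ prodDev dev) q v = euclideanProdEquivComplex n
            (vderiv (𝓘(ℝ, EuclideanSpace ℝ (Fin n)).prod 𝓘(ℝ, EuclideanSpace ℝ (Fin n)))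
              (prodDev dev) q v) := fun v =>
        congrArg (fun L : EuclideanSpace ℝ (Fin n) × EuclideanSpace ℝ (Fin n) →L[ℝ]
          EuclideanSpace ℂ (Fin n) => L v) hd
      rw [hz, hz, ← euclideanProdEquivComplex_mulIMap]
      exact congrArg _ (vderiv_prodDev_rComplexStructure hdev q v)

theorem isSelfsimilarKahler_rSmoothMetric {g : SmoothMetric 𝓘(ℝ, EuclideanSpace ℝ (Fin n)) M}
    {ξ : (p : M) → TangentSpace 𝓘(ℝ, EuclideanSpace ℝ (Fin n)) p}
    (h : IsSelfsimilarHessian g ξ) {dev : M → EuclideanSpace ℝ (Fin n)}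
    (hdev : IsDevelopmentMap dev) {η : EuclideanSpace ℝ (Fin n) →ᴬ[ℝ] EuclideanSpace ℝ (Fin n)}
    (hη : IsDevelopedField dev ξ η) :
    IsSelfsimilarKahler (rComplexStructure dev) (rSmoothMetric g h.hessian hdev)
      (sumField ξ η) where
  kahler :=
    { complex := isComplexStructure_rComplexStructure hdev
      hermitian := fun p v w => rForm_rComplexStructure hdev p v w
      closed := fun p X Y Z hX hY hZ => by
        obtain ⟨f, hf⟩ := h.hessian.exists_isPotentialNear hdev p.1
        exact hf.closed hdev hX hY hZ }
  holomorphic := isHolomorphicField_sumField hdev hη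
  homothetic := lieDerivEqTwice_rSmoothMetric h.hessian hdev hη h.smooth h.homothetic

end ComplexCoordinates

end

theorem mainTheorem6 {n : ℕ} {M : Type*} [TopologicalSpace M] [T2Space M]
    [SecondCountableTopology M] [ChartedSpace (EuclideanSpace ℝ (Fin n)) M]
    [HasGroupoid M (affineGroupoid (EuclideanSpace ℝ (Fin n)))] [SimplyConnectedSpace M]
    (g : SmoothMetric 𝓘(ℝ, EuclideanSpace ℝ (Fin n)) M)
    (ξ : (p : M) → TangentSpace 𝓘(ℝ, EuclideanSpace ℝ (Fin n)) p)
    (hξ : IsSelfsimilarHessian g ξ) :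
    (∃ dev : M → EuclideanSpace ℝ (Fin n), IsDevelopmentMap dev) ∧
    ∀ dev : M → EuclideanSpace ℝ (Fin n), IsDevelopmentMap dev →
      ∃ η : EuclideanSpace ℝ (Fin n) →ᴬ[ℝ] EuclideanSpace ℝ (Fin n),
        IsDevelopedField dev ξ η ∧
        (∀ η', IsDevelopedField dev ξ η' → η' = η) ∧
        ∃ G : SmoothMetric
            (𝓘(ℝ, EuclideanSpace ℝ (Fin n)).prod 𝓘(ℝ, EuclideanSpace ℝ (Fin n)))
            (M × EuclideanSpace ℝ (Fin n)),
          (∀ p X Y, G.inner p X Y = rMetric g dev p X Y) ∧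
          IsSelfsimilarKahler (rComplexStructure dev) G (sumField ξ η) := by
  refine ⟨exists_isDevelopmentMap, fun dev hdev => ?_⟩
  obtain ⟨η, hη⟩ := hξ.affine.exists_developedField hdev
  exact ⟨η, hη, fun η' hη' => hη.unique hdev hη', rSmoothMetric g hξ.hessian hdev,
    fun p X Y => (rMetric_eq_rForm g dev p X Y).symm,
    isSelfsimilarKahler_rSmoothMetric hξ hdev hη⟩
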